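/- Let $\Phi$ be a set of primitive propositions and let $\mathcal L^C$ be the closure of $\Phi$ under $\neg$, $\wedge$ and a binary conditional $\to$; the connectives $\vee,\Rightarrow,\Leftrightarrow$ are defined as usual, $\mathit{true}$ stands for any formula $\chi\vee\neg\chi$, and $\mathit{false}$ for $\neg\mathit{true}$. System $\mathbf C$ has the axioms - C0. all substitution instances of propositional tautologies; - C1. $\varphi\to\varphi$; - C2. $((\varphi\to\psi_1)\wedge(\varphi\to\psi_2))\Rightarrow(\varphi\to(\psi_1\wedge\psi_2))$; - C3. $((\varphi_1\to\psi)\wedge(\varphi_2\to\psi))\Rightarrow((\varphi_1\vee\varphi_2)\to\psi)$; - C4. $((\varphi_1\to\varphi_2)\wedge(\varphi_1\to\psi))\Rightarrow((\varphi_1\wedge\varphi_2)\to\psi)$; and the rules R1 (from $\varphi$ and $\varphi\Rightarrow\psi$ infer $\psi$), RC1 (from $\varphi\Leftrightarrow\varphi'$ infer $(\varphi\to\psi)\Rightarrow(\varphi'\to\psi)$) and RC2 (from $\psi\Rightarrow\psi'$ infer $(\varphi\to\psi)\Rightarrow(\varphi\to\psi')$). Further axioms are - C5. $((\varphi\to\psi)\wedge\neg(\varphi\to\neg\xi))\Rightarrow((\varphi\wedge\xi)\to\psi)$;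 - C6. $\neg(\mathit{true}\to\mathit{false})$. A plausibility space $(\Omega,\mathcal F,\mathrm{Pl})$ is a set $\Omega$, an algebra $\mathcal F$ of subsets of $\Omega$, and a monotone map $\mathrm{Pl}$ from $\mathcal F$ to a partially ordered set with least element $\bot$ and greatest element $\top$ such that $\mathrm{Pl}(\emptyset)=\bot$ and $\mathrm{Pl}(\Omega)=\top$. A (generalized) plausibility structure $(W,\mathcal P,\pi)$ consists of a set $W$ of worlds, a plausibility space $\mathcal P(w)=(W_w,\mathcal F_w,\mathrm{Pl}_w)$ with $W_w\subseteq W$ for each $w\in W$, and a truth assignment $\pi(w)$ to $\Phi$ for each $w\in W$. Truth at a world is defined as usual for primitive propositions, $\neg$ and $\wedge$, and $\varphi\to\psi$ is true at $w$ iff $\mathrm{Pl}_w([\varphi]_w)=\bot$ or $\mathrm{Pl}_w([\varphi\wedge\psi]_w)>\mathrm{Pl}_w([\varphi\wedge\neg\psi]_w)$, where $[\varphi]_w$ is the set of worlds in $W_w$ at which $\varphi$ is true; it is required that $[\varphi]_w\in\mathcal F_w$ for all $w$ and all $\varphi\in\mathcal L^C$. Consider the following classes of plausibility structures, each given by a condition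 on every $\mathcal P(w)$: - $\mathcal S_c^\epsilon$: there is a sequence $(\Pr_i)_{i\ge0}$ of finitely additive probability measures on $\mathcal F_w$ such that, for $A,B\in\mathcal F_w$, $\mathrm{Pl}_w(A)\le\mathrm{Pl}_w(B)$ iff $\lim_{i\to\infty}\Pr_i(B\mid A\cup B)=1$, where $\Pr_i(\cdot\mid C)=1$ if $\Pr_i(C)=0$; - $\mathcal S_c^\kappa$: there is $\kappa:2^{W_w}\to\mathbb N\cup\{\infty\}$ with $\kappa(W_w)=0$, $\kappa(\emptyset)=\infty$ and $\kappa(A)=\min_{x\in A}\kappa(\{x\})$ for all nonempty $A$, such that, for $A,B\in\mathcal F_w$, $\mathrm{Pl}_w(A)\le\mathrm{Pl}_w(B)$ iff $\kappa(B)\le\kappa(A)$; - $\mathcal S_c^{Poss}$: there is $\mathrm{Poss}:2^{W_w}\to[0,1]$ with $\mathrm{Poss}(W_w)=1$, $\mathrm{Poss}(\emptyset)=0$ and $\mathrm{Poss}(A)=\sup_{x\in A}\mathrm{Poss}(\{x\})$ for all $A$ (with $\sup\emptyset=0$), such that, for $A,B\in\mathcal F_w$, $\mathrm{Pl}_w(A)\le\mathrm{Pl}_w(B)$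 iff $\mathrm{Poss}(A)\le\mathrm{Poss}(B)$. An axiom system is sound (complete) for a class of structures if every provable formula is true at every world of every structure in the class (if every formula with the latter property is provable). **Theorem.** (a) $\mathbf C+\{\mathrm{C6}\}$ is sound and complete for $\mathcal S_c^\epsilon$. (b) $\mathbf C+\{\mathrm{C5},\mathrm{C6}\}$ is sound and complete for $\mathcal S_c^\kappa$, and it is sound and complete for $\mathcal S_c^{Poss}$. -/

import Mathlib

open Set Filter Topology

universe u v

namespace CondLogic

/-! ### Syntax -/

/-- The language of conditional logic over a set `Φ` of primitive propositions: the closure of `Φ`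
under negation, conjunction and the conditional (default) connective. -/
inductive Form (Φ : Type u) : Type u
  | atom : Φ → Form Φ
  | neg : Form Φ → Form Φ
  | and : Form Φ → Form Φ → Form Φ
  | cond : Form Φ → Form Φ → Form Φ

namespace Form

variable {Φ : Type u}

/-- Disjunction. -/
def or (φ ψ : Form Φ) : Form Φ := neg (and (neg φ) (neg ψ))

/-- Material implication. -/
def imp (φ ψ : Form Φ) : Form Φ := neg (and φ (neg ψ))

/-- Material equivalence. -/
def iff (φ ψ : Form Φ) : Form Φ := and (imp φ ψ) (imp ψ φ)

/-- The formula *true*, written as `χ ∨ ¬χ` (the primitive connectives contain no constant). -/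
def tru (χ : Form Φ) : Form Φ := or χ (neg χ)

/-- The formula *false*, the negation of *true*. -/
def fls (χ : Form Φ) : Form Φ := neg (tru χ)

/-- Substitution instances of propositional tautologies: the formulas that come out true under every
assignment of truth values to all formulas that respects `¬` and `∧`, so that primitive propositions
and conditionals count as propositional letters. -/
def IsTautology (φ : Form Φ) : Prop :=
  ∀ v : Form Φ → Prop,
    (∀ α, v (neg α) ↔ ¬ v α) → (∀ α β, v (and α β) ↔ (v α ∧ v β)) → v φ

end Form

open Form

/-! ### System C and the additional axioms -/

/-- `Provable Ax φ`: the formula `φ` is provable in System **C** together with the axioms `Ax`. -/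
inductive Provable {Φ : Type u} (Ax : Set (Form Φ)) : Form Φ → Prop
  | extra {φ : Form Φ} (h : φ ∈ Ax) : Provable Ax φ
  | C0 {φ : Form Φ} (h : φ.IsTautology) : Provable Ax φ
  | C1 (φ : Form Φ) : Provable Ax (cond φ φ)
  | C2 (φ ψ₁ ψ₂ : Form Φ) :
      Provable Ax (imp (and (cond φ ψ₁) (cond φ ψ₂)) (cond φ (and ψ₁ ψ₂)))
  | C3 (φ₁ φ₂ ψ : Form Φ) :
      Provable Ax (imp (and (cond φ₁ ψ) (cond φ₂ ψ)) (cond (or φ₁ φ₂) ψ))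
  | C4 (φ₁ φ₂ ψ : Form Φ) :
      Provable Ax (imp (and (cond φ₁ φ₂) (cond φ₁ ψ)) (cond (and φ₁ φ₂) ψ))
  | R1 {φ ψ : Form Φ} (h₁ : Provable Ax φ) (h₂ : Provable Ax (imp φ ψ)) : Provable Ax ψ
  | RC1 {φ φ' : Form Φ} (ψ : Form Φ) (h : Provable Ax (iff φ φ')) :
      Provable Ax (imp (cond φ ψ) (cond φ' ψ))
  | RC2 (φ : Form Φ) {ψ ψ' : Form Φ} (h : Provable Ax (imp ψ ψ')) :
      Provable Ax (imp (cond φ ψ) (cond φ ψ'))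

/-- C5 (rational monotonicity): `(φ → ψ) ∧ ¬(φ → ¬ξ) ⇒ (φ ∧ ξ → ψ)`. -/
def axC5 (Φ : Type u) : Set (Form Φ) :=
  {α | ∃ φ ψ ξ : Form Φ,
    α = imp (and (cond φ ψ) (neg (cond φ (neg ξ)))) (cond (and φ ξ) ψ)}

/-- C6 (normality): `¬(true → false)`. -/
def axC6 (Φ : Type u) : Set (Form Φ) :=
  {α | ∃ χ : Form Φ, α = neg (cond (tru χ) (fls χ))}

/-! ### Plausibility spaces and generalized plausibility structures -/

/-- A plausibility space on `Ω`: an algebra `events` of subsets of `Ω`, and a monotone map `Pl` from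
the events to a pointed partially ordered set `Val`, with `Pl Ω = ⊤` and `Pl ∅ = ⊥`. Only the values
of `Pl` on events are meaningful. -/
structure PlausibilitySpace (Ω : Type v) where
  events : Set (Set Ω)
  isAlgebra : MeasureTheory.IsSetAlgebra events
  Val : Type v
  [instPartialOrder : PartialOrder Val]
  [instBoundedOrder : BoundedOrder Val]
  Pl : Set Ω → Val
  Pl_univ : Pl univ = ⊤
  Pl_empty : Pl ∅ = ⊥
  Pl_mono : ∀ A ∈ events, ∀ B ∈ events, A ⊆ B → Pl A ≤ Pl B

attribute [instance] PlausibilitySpace.instPartialOrder PlausibilitySpace.instBoundedOrder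

/-- The data `(W, P, π)` of a generalized plausibility structure: worlds, for every world `w` a
plausibility space on a set `dom w` of worlds, and a truth assignment at every world. -/
structure PreStructure (Φ : Type u) where
  World : Type v
  dom : World → Set World
  space : ∀ w : World, PlausibilitySpace (dom w)
  val : World → Φ → Prop

/-- Truth of a formula at a world. -/
def Sat {Φ : Type u} (M : PreStructure.{u, v} Φ) : M.World → Form Φ → Prop
  | w, .atom p => M.val w p
  | w, .neg φ => ¬ Sat M w φ
  | w, .and φ ψ => Sat M w φ ∧ Sat M w ψ
  | w, .cond φ ψ =>
      (M.space w).Pl {x : M.dom w | Sat M x φ} = ⊥ ∨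
        (M.space w).Pl {x : M.dom w | Sat M x φ ∧ ¬ Sat M x ψ} <
          (M.space w).Pl {x : M.dom w | Sat M x φ ∧ Sat M x ψ}

/-- A generalized plausibility structure: the sets of worlds defined by formulas are events. -/
structure PlausibilityStructure (Φ : Type u) extends PreStructure.{u, v} Φ where
  measurable : ∀ (w : World) (φ : Form Φ),
    {x : dom w | Sat toPreStructure x φ} ∈ (space w).events

/-- `φ` is valid in a class of structures: it is true at every world of each of them. -/
def Valid {Φ : Type u} (S : Set (PlausibilityStructure.{u, v} Φ)) (φ : Form Φ) : Prop :=
  ∀ M ∈ S, ∀ w : M.World, Sat M.toPreStructure w φ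

/-! ### Probability, ordinal rankings, possibility -/

/-- `μ` is a (finitely additive) probability measure on the algebra `F`. -/
structure IsProbability {Ω : Type v} (F : Set (Set Ω)) (μ : Set Ω → ℝ) : Prop where
  mem_Icc : ∀ A ∈ F, μ A ∈ Icc (0 : ℝ) 1
  empty : μ ∅ = 0
  univ : μ univ = 1
  add : ∀ A ∈ F, ∀ B ∈ F, Disjoint A B → μ (A ∪ B) = μ A + μ B

open Classical in
/-- Conditional probability of `B` given `A`, taken to be `1` if `A` has probability `0`. -/
noncomputable def condProb {Ω : Type v} (μ : Set Ω → ℝ) (B A : Set Ω) : ℝ :=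
  if μ A = 0 then 1 else μ (B ∩ A) / μ A

/-- An ordinal ranking (`κ`-ranking) on `Ω`. -/
structure IsRanking {Ω : Type v} (κ : Set Ω → ℕ∞) : Prop where
  univ : κ univ = 0
  empty : κ ∅ = ⊤
  isLeast : ∀ A : Set Ω, A.Nonempty → IsLeast ((fun w => κ {w}) '' A) (κ A)

/-- A possibility measure on `Ω`. -/
structure IsPossibility {Ω : Type v} (poss : Set Ω → unitInterval) : Prop where
  univ : poss univ = 1
  empty : poss ∅ = 0
  isLUB : ∀ A : Set Ω, IsLUB ((fun w => poss {w}) '' A) (poss A)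

/-- The plausibility space `S` arises from a parameterized probability distribution:
`Pl A ≤ Pl B` iff `lim Prᵢ(B | A ∪ B) = 1`. -/
def ArisesFromPPD {Ω : Type v} (S : PlausibilitySpace Ω) : Prop :=
  ∃ Pr : ℕ → Set Ω → ℝ, (∀ i, IsProbability S.events (Pr i)) ∧
    ∀ A ∈ S.events, ∀ B ∈ S.events,
      S.Pl A ≤ S.Pl B ↔ Tendsto (fun i => condProb (Pr i) B (A ∪ B)) atTop (𝓝 1)

/-- The plausibility space `S` arises from an ordinal ranking: a smaller rank is more plausible. -/
def ArisesFromRanking {Ω : Type v} (S : PlausibilitySpace Ω) : Prop :=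
  ∃ κ : Set Ω → ℕ∞, IsRanking κ ∧
    ∀ A ∈ S.events, ∀ B ∈ S.events, S.Pl A ≤ S.Pl B ↔ κ B ≤ κ A

/-- The plausibility space `S` arises from a possibility measure. -/
def ArisesFromPossibility {Ω : Type v} (S : PlausibilitySpace Ω) : Prop :=
  ∃ poss : Set Ω → unitInterval, IsPossibility poss ∧
    ∀ A ∈ S.events, ∀ B ∈ S.events, S.Pl A ≤ S.Pl B ↔ poss A ≤ poss B

/-- The class of `ε`-semantics structures. -/
def epsilonStructures (Φ : Type u) : Set (PlausibilityStructure.{u, v} Φ) :=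
  {M | ∀ w, ArisesFromPPD (M.space w)}

/-- The class of `κ`-ranking structures. -/
def rankingStructures (Φ : Type u) : Set (PlausibilityStructure.{u, v} Φ) :=
  {M | ∀ w, ArisesFromRanking (M.space w)}

/-- The class of possibility structures. -/
def possibilityStructures (Φ : Type u) : Set (PlausibilityStructure.{u, v} Φ) :=
  {M | ∀ w, ArisesFromPossibility (M.space w)}

/-- A set `Ax` of axioms, added to System **C**, is sound for the class `S`. -/
def Sound {Φ : Type u} (Ax : Set (Form Φ)) (S : Set (PlausibilityStructure.{u, v} Φ)) : Prop :=
  ∀ φ : Form Φ, Provable Ax φ → Valid S φ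

/-- A set `Ax` of axioms, added to System **C**, is complete for the class `S`. -/
def Complete {Φ : Type u} (Ax : Set (Form Φ)) (S : Set (PlausibilityStructure.{u, v} Φ)) : Prop :=
  ∀ φ : Form Φ, Valid S φ → Provable Ax φ

end CondLogic

/-! Soundness reduces to set algebra. In each class the relation on events interpreting the
conditional is preferential, the conditions matching C1–C4 and RC2. For a sequence of measures, `A →
B` says that the share of `A \ B` in `A` tends to zero (`rel_iff_ppd`). For a possibility measure it
says that `A \ B` is less possible than `A`, or `A` is impossible (`rel_iff_poss`); totality of the
order then gives C5. Rankings embed into possibility measures by `n ↦ 1 / (n + 1)`.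

Completeness is a finite canonical model argument (`complete_of_representation`). The worlds are
maximal consistent theories, one for each truth pattern on the subformulas of the given formula.
Every set of worlds is defined by a formula, so each theory induces a preferential relation on all
sets of worlds, rational when C5 is available. It remains to realise such a relation on a finite set
by a space of the right kind.

A rational relation comes from a single ranking, built layer by layer: the first layer of `R` is the
set of points `x` for which `R → R \ {x}` fails (`IsPreferential.exists_ranking`). A merely
preferential relation is an intersection of linear rankings, one refuting each conditional that
fails (`IsPreferential.exists_linear_ranking_not`). These finitely many rankings are interleaved
into one sequence of measures in which every ranking recurs infinitely often, with weights `ε ^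
rank` and `ε → 0`, so a limit along the sequence tests all rankings at once
(`arisesFromPPD_rankSpace`). -/

namespace CondLogic

open Form

/-! ### Preferential relations -/

section Preferential

variable {Ω : Type v}

/-- The semantic counterpart of System **C** for a relation between the events of an algebra. -/
structure IsPreferential (F : Set (Set Ω)) (r : Set Ω → Set Ω → Prop) : Prop where
  refl : ∀ A ∈ F, r A A
  inter : ∀ A ∈ F, ∀ B ∈ F, ∀ C ∈ F, r A B → r A C → r A (B ∩ C)
  union : ∀ A ∈ F, ∀ B ∈ F, ∀ C ∈ F, r A C → r B C → r (A ∪ B) C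
  cautious : ∀ A ∈ F, ∀ B ∈ F, ∀ C ∈ F, r A B → r A C → r (A ∩ B) C
  weaken : ∀ A ∈ F, ∀ B ∈ F, ∀ C ∈ F, r A B → A ∩ B ⊆ C → r A C

/-- Rational monotonicity, the semantic counterpart of C5. -/
def IsRational (F : Set (Set Ω)) (r : Set Ω → Set Ω → Prop) : Prop :=
  ∀ A ∈ F, ∀ B ∈ F, ∀ C ∈ F, r A B → ¬ r A Cᶜ → r (A ∩ C) B

/-- `A → B` holds in the ranking `k` of points: every point of `A \ B` of finite rank is beaten by
a point of `A ∩ B`. -/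
def RankHolds (k : Ω → ℕ∞) (A B : Set Ω) : Prop :=
  ∀ x ∈ A, x ∉ B → k x < ⊤ → ∃ y ∈ A, y ∈ B ∧ k y < k x

/-- Distinct points of finite rank have distinct ranks. -/
def IsLinearRanking (k : Ω → ℕ∞) : Prop := ∀ x y, k x = k y → k x < ⊤ → x = y

variable {r : Set Ω → Set Ω → Prop}

/-- Both `C` and `R \ C` conditionally exclude `x`, and C3 joins them. Contrapositively, a point
that `R` cannot exclude survives in every smaller `C` containing it, so `C → D` forces `x ∈ D`. -/
theorem IsPreferential.mono_left (h : IsPreferential Set.univ r) {C R : Set Ω} {x : Ω}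
    (hCR : C ⊆ R) (hx : x ∈ C) {D : Set Ω} (hxD : x ∉ D) (hr : r C D) : r R (R \ {x}) := by
  have h1 : r C (R \ {x}) := h.weaken _ trivial _ trivial _ trivial hr fun y hy =>
    ⟨hCR hy.1, fun hyx => hxD (hyx ▸ hy.2)⟩
  have h2 : r (R \ C) (R \ {x}) :=
    h.weaken _ trivial _ trivial _ trivial (h.refl (R \ C) trivial) fun y hy =>
      ⟨hy.1.1, fun hyx => hy.1.2 (hyx ▸ hx)⟩
  have h3 := h.union _ trivial _ trivial _ trivial h1 h2
  rwa [union_sdiff_cancel hCR] at h3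

theorem IsPreferential.diff_of_forall [Finite Ω] (h : IsPreferential Set.univ r) (R T : Set Ω)
    (hT : ∀ x ∈ T, r R (R \ {x})) : r R (R \ T) := by
  induction T, T.toFinite using Set.Finite.induction_on with
  | empty => simpa using h.refl R trivial
  | @insert a T _ _ ih =>
    have h1 := h.inter _ trivial _ trivial _ trivial (hT a (mem_insert _ _))
      (ih fun x hx => hT x (mem_insert_of_mem _ hx))
    exact h.weaken _ trivial _ trivial _ trivial h1 fun y hy => by
      simp only [mem_inter_iff, Set.mem_sdiff, mem_singleton_iff, mem_insert_iff] at hy ⊢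
      tauto

/-- If `A → B` fails, then inside every `R ⊇ A` there is a candidate for a most plausible point
that does not spoil the failure. -/
theorem IsPreferential.exists_candidate [Finite Ω] (h : IsPreferential Set.univ r)
    {A B R : Set Ω} (hAR : A ⊆ R) (hAB : ¬ r A B) :
    ∃ x ∈ R, ¬ r R (R \ {x}) ∧ ¬ (x ∈ A ∧ x ∈ B) := by
  by_contra! hc
  -- If `R` excluded each point outside `A ∩ B`, it would exclude them all at once; cautious
  -- monotonicity would then pass from `R` to `A` and yield `A → B`.
  have h1 : r R (R \ (R \ (A ∩ B))) := h.diff_of_forall R _ fun x hx => by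
    by_contra hn
    exact hx.2 (hc x hx.1 hn)
  have h2 : r R A := h.weaken _ trivial _ trivial _ trivial h1 fun y hy => by
    simp only [mem_inter_iff, Set.mem_sdiff] at hy; tauto
  have h3 : r R B := h.weaken _ trivial _ trivial _ trivial h1 fun y hy => by
    simp only [mem_inter_iff, Set.mem_sdiff] at hy; tauto
  have h4 := h.cautious _ trivial _ trivial _ trivial h2 h3
  rw [inter_eq_right.2 hAR] at h4
  exact hAB h4

open Classical in
/-- The ranking that puts the points of `L` first and then continues with `k`. -/
noncomputable def prependRank (L : Set Ω) (k : Ω → ℕ∞) (x : Ω) : ℕ∞ := if x ∈ L then 0 else k x + 1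

theorem rankHolds_prependRank_of_disjoint {L : Set Ω} {k : Ω → ℕ∞} {A B : Set Ω}
    (hA : Disjoint A L) : RankHolds (prependRank L k) A B ↔ RankHolds k A B := by
  have hn : ∀ x ∈ A, x ∉ L := fun x hx hL => hA.le_bot ⟨hx, hL⟩
  have hk : ∀ x ∈ A, prependRank L k x = k x + 1 := fun x hx => if_neg (hn x hx)
  refine forall₂_congr fun x hx => forall_congr' fun _ => ?_
  have h1 : k x + 1 < ⊤ ↔ k x < ⊤ := by
    simp [lt_top_iff_ne_top]
  rw [hk x hx, h1]
  refine forall_congr' fun _ => exists_congr fun y => and_congr_right fun hy => ?_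
  rw [hk y hy, ENat.add_lt_add_iff_right (by simp)]

theorem rankHolds_prependRank_of_mem {L : Set Ω} {k : Ω → ℕ∞} {A B : Set Ω}
    (hA : (A ∩ L).Nonempty) : RankHolds (prependRank L k) A B ↔ A ∩ L ⊆ B := by
  have hk : ∀ x, x ∉ L → prependRank L k x = k x + 1 := fun x hx => if_neg hx
  have hk0 : ∀ x ∈ L, prependRank L k x = 0 := fun x hx => if_pos hx
  constructor
  · rintro h x ⟨hxA, hxL⟩
    by_contra hxB
    obtain ⟨y, -, -, hy⟩ := h x hxA hxB (by simp [hk0 x hxL])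
    simp [hk0 x hxL] at hy
  · intro h x hxA hxB _
    obtain ⟨y, hyA, hyL⟩ := hA
    refine ⟨y, hyA, h ⟨hyA, hyL⟩, ?_⟩
    rw [hk0 y hyL, hk x fun hxL => hxB (h ⟨hxA, hxL⟩)]
    simp

theorem isLinearRanking_prependRank {k : Ω → ℕ∞} (x : Ω) (hk : IsLinearRanking k) :
    IsLinearRanking (prependRank {x} k) := by
  intro y z
  unfold prependRank
  split_ifs with hy hz hz
  · intros; exact hy.trans hz.symm
  · intro he; exact absurd he.symm (by simp)
  · intro he; simp at he
  · intro he ht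
    exact hk y z (WithTop.add_right_cancel ENat.one_ne_top he) (lt_of_le_of_lt le_self_add ht)

/-- Induction step for linear rankings: a set containing `x` is judged by `x` alone, which
`mono_left` settles, and any other set is left to `k`. -/
theorem IsPreferential.rankHolds_prependRank (h : IsPreferential Set.univ r) {R : Set Ω} {x : Ω}
    (hx : ¬ r R (R \ {x})) {k : Ω → ℕ∞} (hk : ∀ C ⊆ R \ {x}, ∀ D, r C D → RankHolds k C D)
    {C D : Set Ω} (hC : C ⊆ R) (hCD : r C D) : RankHolds (prependRank {x} k) C D := by
  by_cases hxC : x ∈ C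
  · rw [rankHolds_prependRank_of_mem ⟨x, hxC, mem_singleton x⟩]
    rintro y ⟨-, rfl⟩
    by_contra hyD
    exact hx (h.mono_left hC hxC hyD hCD)
  · rw [rankHolds_prependRank_of_disjoint (by simpa using hxC)]
    exact hk C (subset_sdiff_singleton hC hxC) D hCD

theorem IsPreferential.exists_linear_ranking [Finite Ω] (h : IsPreferential Set.univ r)
    (R : Set Ω) : ∃ k : Ω → ℕ∞, IsLinearRanking k ∧
      (∀ C ⊆ R, ∀ D, r C D → RankHolds k C D) := by
  induction hn : R.ncard using Nat.strong_induction_on generalizing R with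
  | _ n ih =>
  by_cases hR : r R ∅
  · exact ⟨fun _ => ⊤, fun _ _ _ h => absurd h (lt_irrefl _),
      fun C _ D _ x _ _ hx => absurd hx (lt_irrefl _)⟩
  obtain ⟨x, hxR, hx, -⟩ := h.exists_candidate Subset.rfl hR
  obtain ⟨k, hk, hk'⟩ := ih _ (by rw [← hn]; exact ncard_sdiff_singleton_lt_of_mem hxR) (R \ {x}) rfl
  refine ⟨prependRank {x} k, ?_, fun C hC D hCD => ?_⟩
  · exact isLinearRanking_prependRank x hk
  · exact h.rankHolds_prependRank hx hk' hC hCD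

theorem IsPreferential.exists_linear_ranking_not [Finite Ω] (h : IsPreferential Set.univ r)
    {A B : Set Ω} (hAB : ¬ r A B) (R : Set Ω) (hAR : A ⊆ R) :
    ∃ k : Ω → ℕ∞, IsLinearRanking k ∧ (∃ x, k x = 0) ∧
      (∀ C ⊆ R, ∀ D, r C D → RankHolds k C D) ∧ ¬ RankHolds k A B := by
  induction hn : R.ncard using Nat.strong_induction_on generalizing R with
  | _ n ih =>
  obtain ⟨x, hxR, hx, hxAB⟩ := h.exists_candidate hAR hAB
  -- The refutation is complete once the chosen point lies in `A`, for then it lies outside `B`;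
  -- until then the remaining ranking must still refute `A → B`.
  have key : ∃ k : Ω → ℕ∞, IsLinearRanking k ∧
      (∀ C ⊆ R \ {x}, ∀ D, r C D → RankHolds k C D) ∧ (x ∉ A → ¬ RankHolds k A B) := by
    by_cases hxA : x ∈ A
    · obtain ⟨k, h1, h2⟩ := h.exists_linear_ranking (R \ {x})
      exact ⟨k, h1, h2, fun h => absurd hxA h⟩
    · obtain ⟨k, h1, -, h2, h3⟩ := ih _
        (by rw [← hn]; exact ncard_sdiff_singleton_lt_of_mem hxR) (R \ {x})
        (subset_sdiff_singleton hAR hxA) rfl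
      exact ⟨k, h1, h2, fun _ => h3⟩
  obtain ⟨k, hk, hk', hkA⟩ := key
  refine ⟨prependRank {x} k, ?_, ⟨x, if_pos rfl⟩, fun C hC D hCD => ?_, ?_⟩
  · exact isLinearRanking_prependRank x hk
  · exact h.rankHolds_prependRank hx hk' hC hCD
  · by_cases hxA : x ∈ A
    · rw [rankHolds_prependRank_of_mem ⟨x, hxA, mem_singleton x⟩]
      exact fun hs => hxAB ⟨hxA, hs ⟨hxA, rfl⟩⟩
    · rw [rankHolds_prependRank_of_disjoint (by simpa using hxA)]
      exact hkA hxA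

theorem IsPreferential.exists_ranking [Finite Ω] (h : IsPreferential Set.univ r)
    (hr : IsRational Set.univ r) (R : Set Ω) :
    ∃ k : Ω → ℕ∞, (¬ r R ∅ → ∃ x, k x = 0) ∧ ∀ C ⊆ R, ∀ D, r C D ↔ RankHolds k C D := by
  induction hn : R.ncard using Nat.strong_induction_on generalizing R with
  | _ n ih =>
  by_cases hR : r R ∅
  · refine ⟨fun _ => ⊤, fun h => absurd hR h, fun C hC D =>
      ⟨fun _ x _ _ hx => absurd hx (lt_irrefl _), fun _ => ?_⟩⟩
    have h1 := h.cautious _ trivial C trivial _ trivial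
      (h.weaken _ trivial _ trivial _ trivial hR (by simp)) hR
    rw [inter_eq_right.2 hC] at h1
    exact h.weaken _ trivial _ trivial _ trivial h1 (by simp)
  -- All candidates for most plausible point form one layer. Rationality is what makes this layer
  -- decide every set that meets it.
  set L : Set Ω := {x ∈ R | ¬ r R (R \ {x})} with hL
  obtain ⟨x, hxR, hx, -⟩ := h.exists_candidate Subset.rfl hR
  have hxL : x ∈ L := ⟨hxR, hx⟩
  have hlt : (R \ L).ncard < n := by
    rw [← hn]
    exact ncard_lt_ncard ⟨sdiff_subset, fun hs => (hs hxR).2 hxL⟩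
  obtain ⟨k, -, hk⟩ := ih _ hlt (R \ L) rfl
  refine ⟨prependRank L k, fun _ => ⟨x, if_pos hxL⟩, fun C hC D => ?_⟩
  rcases (C ∩ L).eq_empty_or_nonempty with he | hne
  · have hd : Disjoint C L := disjoint_iff_inter_eq_empty.2 he
    rw [rankHolds_prependRank_of_disjoint hd]
    exact hk C (subset_sdiff.2 ⟨hC, hd⟩) D
  · rw [rankHolds_prependRank_of_mem hne]
    constructor
    · rintro hCD y ⟨hyC, hyL⟩
      by_contra hyD
      exact hyL.2 (h.mono_left hC hyC hyD hCD)
    · intro hs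
      have h1 : r R (R \ (R \ L)) := h.diff_of_forall R _ fun y hy => by
        by_contra hn
        exact hy.2 ⟨hy.1, hn⟩
      have h2 : ¬ r R Cᶜ := by
        intro hc
        obtain ⟨y, hyC, hyL⟩ := hne
        exact hyL.2 (h.weaken _ trivial _ trivial _ trivial hc fun z hz =>
          ⟨hz.1, fun hzy => hz.2 (hzy ▸ hyC)⟩)
      -- `R → L` holds and `R → Cᶜ` fails, so rational monotonicity gives `C → L`.
      have h3 := hr _ trivial _ trivial _ trivial h1 h2
      rw [inter_eq_right.2 hC] at h3
      refine h.weaken _ trivial _ trivial _ trivial h3 fun y hy => hs ⟨hy.1, ?_⟩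
      by_contra hyL
      exact hy.2.2 ⟨hC hy.1, hyL⟩

end Preferential

/-! ### Maximal consistent theories -/

section Lindenbaum

variable {Φ : Type u}

/-- A truth assignment to all formulas that respects `¬` and `∧` and makes the theorems of
**C** + `Ax` true, that is, a maximal consistent theory. -/
structure IsModel (Ax : Set (Form Φ)) (m : Form Φ → Prop) : Prop where
  neg : ∀ α, m (neg α) ↔ ¬ m α
  and : ∀ α β, m (and α β) ↔ m α ∧ m β
  provable : ∀ α, Provable Ax α → m α

/-- A set of formulas that contains the theorems of **C** + `Ax` and is closed under modus ponens. -/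
structure IsTheory (Ax : Set (Form Φ)) (T : Set (Form Φ)) : Prop where
  provable : ∀ α, Provable Ax α → α ∈ T
  mp : ∀ α β, α ∈ T → imp α β ∈ T → β ∈ T

variable {Ax : Set (Form Φ)}

theorem IsTheory.mem_of_forall {T : Set (Form Φ)} (hT : IsTheory Ax T) {α : Form Φ}
    (h : IsTautology α) : α ∈ T := hT.provable _ (.C0 h)

/-- Zorn's lemma on theories omitting `α`. Theories are closed only under modus ponens, since RC1
and RC2 apply to theorems and not to arbitrary assumptions. -/
theorem exists_isModel_not {α : Form Φ} (hα : ¬ Provable Ax α) : ∃ m, IsModel Ax m ∧ ¬ m α := by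
  obtain ⟨T, hT⟩ := zorn_subset {T : Set (Form Φ) | IsTheory Ax T ∧ α ∉ T} (by
    intro c hc hch
    rcases c.eq_empty_or_nonempty with rfl | ⟨T₀, hT₀⟩
    · exact ⟨{β | Provable Ax β}, ⟨⟨fun _ h => h, fun _ _ h1 h2 => .R1 h1 h2⟩, hα⟩, by simp⟩
    refine ⟨⋃₀ c, ⟨⟨fun β hβ => ⟨T₀, hT₀, (hc hT₀).1.provable β hβ⟩, ?_⟩, ?_⟩,
      fun s hs => subset_sUnion_of_mem hs⟩
    · rintro β γ ⟨T₁, h1, hβ⟩ ⟨T₂, h2, hγ⟩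
      rcases hch.total h1 h2 with hle | hle
      · exact ⟨T₂, h2, (hc h2).1.mp β γ (hle hβ) hγ⟩
      · exact ⟨T₁, h1, (hc h1).1.mp β γ hβ (hle hγ)⟩
    · rintro ⟨S, hS, h⟩
      exact (hc hS).2 h)
  have hTh : IsTheory Ax T := hT.prop.1
  have hαT : α ∉ T := hT.prop.2
  -- The set of `γ` with `β ⇒ γ` in `T` is a theory containing `T` and `β`; by maximality of `T` it
  -- must contain `α`.
  have ded : ∀ β, β ∉ T → imp β α ∈ T := by
    intro β hβ
    by_contra hn
    have hle : T ⊆ {γ | imp β γ ∈ T} := fun γ hγ => hTh.mp γ _ hγ (hTh.mem_of_forall (by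
      intro v hneg hand; simp only [imp, hneg, hand]; tauto))
    have hth : IsTheory Ax {γ | imp β γ ∈ T} := by
      refine ⟨fun γ hγ => hle (hTh.provable γ hγ), fun γ δ h1 h2 => ?_⟩
      refine hTh.mp _ _ h2 (hTh.mp _ _ h1 (hTh.mem_of_forall ?_))
      intro v hneg hand; simp only [imp, hneg, hand]; tauto
    have := hT.le_of_ge ⟨hth, hn⟩ hle
    exact hβ (this (hTh.mem_of_forall (by
      intro v hneg hand; simp only [imp, hneg, hand]; tauto)))
  have hneg : ∀ β, neg β ∈ T ↔ β ∉ T := by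
    intro β
    constructor
    · intro h1 h2
      refine hαT (hTh.mp _ _ h2 (hTh.mp _ _ h1 (hTh.mem_of_forall ?_)))
      intro v hneg hand; simp only [imp, hneg, hand]; tauto
    · intro h1
      by_contra h2
      refine hαT (hTh.mp _ _ (ded _ h2) (hTh.mp _ _ (ded _ h1) (hTh.mem_of_forall ?_)))
      intro v hneg hand; simp only [imp, hneg, hand]; tauto
  refine ⟨fun β => β ∈ T, ⟨hneg, fun β γ => ⟨fun h => ⟨?_, ?_⟩, fun h => ?_⟩, hTh.provable⟩, hαT⟩
  · exact hTh.mp _ _ h (hTh.mem_of_forall (by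
      intro v hneg hand; simp only [imp, hneg, hand]; tauto))
  · exact hTh.mp _ _ h (hTh.mem_of_forall (by
      intro v hneg hand; simp only [imp, hneg, hand]; tauto))
  · exact hTh.mp _ _ h.2 (hTh.mp _ _ h.1 (hTh.mem_of_forall (by
      intro v hneg hand; simp only [imp, hneg, hand]; tauto)))

theorem provable_of_forall_isModel {α : Form Φ} (h : ∀ m, IsModel Ax m → m α) : Provable Ax α := by
  by_contra hα
  obtain ⟨m, hm, hmα⟩ := exists_isModel_not hα
  exact hmα (h m hm)

namespace IsModel

variable {m : Form Φ → Prop}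

theorem imp (hm : IsModel Ax m) (α β : Form Φ) : m (imp α β) ↔ (m α → m β) := by
  simp only [Form.imp, hm.neg, hm.and]; tauto

theorem or (hm : IsModel Ax m) (α β : Form Φ) : m (or α β) ↔ (m α ∨ m β) := by
  simp only [Form.or, hm.neg, hm.and]; tauto

/-- The equivalence is required in all models, because only then is it a theorem to which RC1
applies. -/
theorem cond_congr_left (hm : IsModel Ax m) {φ φ' ψ : Form Φ}
    (h : ∀ n, IsModel Ax n → (n φ ↔ n φ')) : m (cond φ ψ) ↔ m (cond φ' ψ) := by
  have aux : ∀ φ φ', (∀ n, IsModel Ax n → (n φ ↔ n φ')) → m (cond φ ψ) → m (cond φ' ψ) :=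
    fun φ φ' h => (hm.imp _ _).1 (hm.provable _ (.RC1 ψ (provable_of_forall_isModel fun n hn => by
      rw [Form.iff, hn.and, hn.imp, hn.imp]
      exact ⟨(h n hn).1, (h n hn).2⟩)))
  exact ⟨aux _ _ h, aux _ _ fun n hn => (h n hn).symm⟩

theorem cond_mono_right (hm : IsModel Ax m) {φ ψ ψ' : Form Φ}
    (h : ∀ n, IsModel Ax n → n ψ → n ψ') : m (cond φ ψ) → m (cond φ ψ') :=
  (hm.imp _ _).1 (hm.provable _ (.RC2 φ (provable_of_forall_isModel fun n hn =>
    (hn.imp _ _).2 (h n hn))))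

theorem cond_congr_right (hm : IsModel Ax m) {φ ψ ψ' : Form Φ}
    (h : ∀ n, IsModel Ax n → (n ψ ↔ n ψ')) : m (cond φ ψ) ↔ m (cond φ ψ') :=
  ⟨hm.cond_mono_right fun n hn => (h n hn).1, hm.cond_mono_right fun n hn => (h n hn).2⟩

end IsModel

/-! ### Definable sets of models -/

/-- A predicate on models is definable if it is the truth of some formula. -/
def Definable (Ax : Set (Form Φ)) (P : (Form Φ → Prop) → Prop) : Prop :=
  ∃ χ : Form Φ, ∀ m, IsModel Ax m → (m χ ↔ P m)

theorem Definable.neg {P : (Form Φ → Prop) → Prop} (h : Definable Ax P) :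
    Definable Ax fun m => ¬ P m := by
  obtain ⟨χ, hχ⟩ := h
  exact ⟨.neg χ, fun m hm => by rw [hm.neg, hχ m hm]⟩

theorem Definable.forall_mem [Nonempty (Form Φ)] {ι : Type*} {s : Set ι} (hs : s.Finite)
    {P : ι → (Form Φ → Prop) → Prop} (h : ∀ i ∈ s, Definable Ax (P i)) :
    Definable Ax fun m => ∀ i ∈ s, P i m := by
  induction s, hs using Set.Finite.induction_on with
  | empty =>
    -- The empty conjunction needs some formula to build *true* from; over an empty `Φ` there are no
    -- formulas at all.
    obtain ⟨χ⟩ := ‹Nonempty (Form Φ)›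
    exact ⟨tru χ, fun m hm => by simp only [tru, hm.or, hm.neg]; simp; tauto⟩
  | @insert a s _ _ ih =>
    obtain ⟨χ, hχ⟩ := ih fun i hi => h i (mem_insert_of_mem _ hi)
    obtain ⟨χ', hχ'⟩ := h a (mem_insert _ _)
    exact ⟨.and χ' χ, fun m hm => by rw [hm.and, hχ m hm, hχ' m hm]; simp⟩

theorem Definable.exists_mem [Nonempty (Form Φ)] {ι : Type*} {s : Set ι} (hs : s.Finite)
    {P : ι → (Form Φ → Prop) → Prop} (h : ∀ i ∈ s, Definable Ax (P i)) :
    Definable Ax fun m => ∃ i ∈ s, P i m := by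
  have := (Definable.forall_mem hs fun i hi => (h i hi).neg).neg
  simpa using this

theorem Definable.iff_const (α : Form Φ) (p : Prop) : Definable Ax fun m => (m α ↔ p) := by
  by_cases hp : p
  · exact ⟨α, fun m _ => by simp [hp]⟩
  · exact ⟨.neg α, fun m hm => by simp [hp, hm.neg]⟩

/-- Up to agreement on a finite set of formulas there are only finitely many models. -/
theorem exists_finite_models (Ax : Set (Form Φ)) {s : Set (Form Φ)} (hs : s.Finite) :
    ∃ (n : ℕ) (m : Fin n → Form Φ → Prop), (∀ i, IsModel Ax (m i)) ∧
      ∀ m', IsModel Ax m' → ∃! i, ∀ α ∈ s, (m' α ↔ m i α) := by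
  have := hs.to_subtype
  -- The truth patterns on `s` realised by some model; one model is chosen for each.
  let X : Type u := {t : s → Prop // ∃ m, IsModel Ax m ∧ ∀ α : s, (m α ↔ t α)}
  obtain ⟨n, ⟨e⟩⟩ := Finite.exists_equiv_fin X
  choose f hf hf' using fun x : X => x.2
  refine ⟨n, fun i => f (e.symm i), fun i => hf _, fun m' hm' => ?_⟩
  refine ⟨e ⟨fun α => m' α, m', hm', fun _ => Iff.rfl⟩, fun α hα => ?_, fun i hi => ?_⟩
  · beta_reduce
    rw [Equiv.symm_apply_apply]
    exact (hf' ⟨fun α => m' α, m', hm', fun _ => Iff.rfl⟩ ⟨α, hα⟩).symm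
  · rw [← Equiv.symm_apply_eq]
    refine Subtype.ext (funext fun α => propext ?_)
    exact ((hf' _ α).symm).trans (hi α α.2).symm

/-- The set of subformulas of a formula. -/
def subformulas : Form Φ → Set (Form Φ)
  | .atom p => {.atom p}
  | .neg φ => insert (.neg φ) (subformulas φ)
  | .and φ ψ => insert (.and φ ψ) (subformulas φ ∪ subformulas ψ)
  | .cond φ ψ => insert (.cond φ ψ) (subformulas φ ∪ subformulas ψ)

theorem mem_subformulas_self (φ : Form Φ) : φ ∈ subformulas φ := by
  cases φ <;> simp [subformulas]

theorem finite_subformulas (φ : Form Φ) : (subformulas φ).Finite := by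
  induction φ with
  | atom p => exact finite_singleton _
  | neg φ ih => exact ih.insert _
  | and φ ψ ih1 ih2 => exact (ih1.union ih2).insert _
  | cond φ ψ ih1 ih2 => exact (ih1.union ih2).insert _

theorem subformulas_subset {φ ψ : Form Φ} (h : ψ ∈ subformulas φ) :
    subformulas ψ ⊆ subformulas φ := by
  induction φ with
  | atom p => rw [subformulas, mem_singleton_iff] at h; rw [h]
  | neg φ ih =>
    rcases h with rfl | h
    · rfl
    · exact (ih h).trans (subset_insert _ _)
  | and φ ψ ih1 ih2 =>
    rcases h with rfl | h | h
    · rfl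
    · exact (ih1 h).trans (subset_union_left.trans (subset_insert _ _))
    · exact (ih2 h).trans (subset_union_right.trans (subset_insert _ _))
  | cond φ ψ ih1 ih2 =>
    rcases h with rfl | h | h
    · rfl
    · exact (ih1 h).trans (subset_union_left.trans (subset_insert _ _))
    · exact (ih2 h).trans (subset_union_right.trans (subset_insert _ _))

end Lindenbaum

/-! ### Soundness -/

section Soundness

variable {Φ : Type u}

/-- The relation between events that interprets the conditional in a plausibility space. -/
def PlausibilitySpace.Rel {Ω : Type v} (S : PlausibilitySpace Ω) (A B : Set Ω) : Prop :=
  S.Pl A = ⊥ ∨ S.Pl (A \ B) < S.Pl (A ∩ B)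

/-- The worlds of `dom w` at which a formula is true. -/
def PreStructure.truthSet (M : PreStructure.{u, v} Φ) (w : M.World) (φ : Form Φ) :
    Set (M.dom w) := {x | Sat M x φ}

variable {M : PreStructure.{u, v} Φ} {w : M.World}

theorem sat_neg {φ : Form Φ} : Sat M w (neg φ) ↔ ¬ Sat M w φ := Iff.rfl

theorem sat_and {φ ψ : Form Φ} : Sat M w (and φ ψ) ↔ Sat M w φ ∧ Sat M w ψ := Iff.rfl

theorem sat_cond {φ ψ : Form Φ} :
    Sat M w (cond φ ψ) ↔ (M.space w).Rel (M.truthSet w φ) (M.truthSet w ψ) := Iff.rfl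

theorem sat_imp {φ ψ : Form Φ} : Sat M w (imp φ ψ) ↔ (Sat M w φ → Sat M w ψ) := by
  simp only [imp, sat_neg, sat_and]; tauto

theorem sat_or {φ ψ : Form Φ} : Sat M w (or φ ψ) ↔ Sat M w φ ∨ Sat M w ψ := by
  simp only [Form.or, sat_neg, sat_and]; tauto

theorem truthSet_neg (φ : Form Φ) : M.truthSet w (neg φ) = (M.truthSet w φ)ᶜ := rfl

theorem truthSet_or (φ ψ : Form Φ) : M.truthSet w (or φ ψ) = M.truthSet w φ ∪ M.truthSet w ψ :=
  Set.ext fun _ => sat_or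

theorem truthSet_tru (χ : Form Φ) : M.truthSet w (tru χ) = univ := by
  rw [tru, truthSet_or, truthSet_neg, union_compl_self]

theorem truthSet_fls (χ : Form Φ) : M.truthSet w (fls χ) = ∅ := by
  rw [fls, truthSet_neg, truthSet_tru, compl_univ]

/-- Induction on derivations. RC1 needs no condition on the relation: formulas equivalent at every
world have the same truth sets. -/
theorem sound_of_isPreferential {Ax : Set (Form Φ)} {S : Set (PlausibilityStructure.{u, v} Φ)}
    (hS : ∀ M ∈ S, ∀ w, IsPreferential (M.space w).events (M.space w).Rel)
    (hAx : ∀ φ ∈ Ax, Valid S φ) : Sound Ax S := by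
  intro φ hφ
  induction hφ with
  | extra h => exact hAx _ h
  | C0 h => exact fun M _ w => h (Sat M.toPreStructure w) (fun _ => Iff.rfl) fun _ _ => Iff.rfl
  | C1 φ => exact fun M hM w => (hS M hM w).refl _ (M.measurable w φ)
  | C2 φ ψ₁ ψ₂ =>
    exact fun M hM w => sat_imp.2 fun h => (hS M hM w).inter _ (M.measurable w φ) _
      (M.measurable w ψ₁) _ (M.measurable w ψ₂) h.1 h.2
  | C3 φ₁ φ₂ ψ =>
    intro M hM w
    refine sat_imp.2 fun h => sat_cond.2 ?_
    rw [truthSet_or]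
    exact (hS M hM w).union _ (M.measurable w φ₁) _ (M.measurable w φ₂) _ (M.measurable w ψ) h.1 h.2
  | C4 φ₁ φ₂ ψ =>
    exact fun M hM w => sat_imp.2 fun h => (hS M hM w).cautious _ (M.measurable w φ₁) _
      (M.measurable w φ₂) _ (M.measurable w ψ) h.1 h.2
  | R1 _ _ ih₁ ih₂ => exact fun M hM w => sat_imp.1 (ih₂ M hM w) (ih₁ M hM w)
  | @RC1 φ φ' ψ _ ih =>
    intro M hM w
    have he : M.truthSet w φ = M.truthSet w φ' := Set.ext fun x =>
      ⟨sat_imp.1 (ih M hM x).1, sat_imp.1 (ih M hM x).2⟩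
    refine sat_imp.2 fun h => sat_cond.2 ?_
    rw [← he]
    exact h
  | @RC2 φ ψ ψ' _ ih =>
    exact fun M hM w => sat_imp.2 fun h => (hS M hM w).weaken _ (M.measurable w φ) _
      (M.measurable w ψ) _ (M.measurable w ψ') h fun x hx => sat_imp.1 (ih M hM x) hx.2

theorem valid_of_mem_axC5 {S : Set (PlausibilityStructure.{u, v} Φ)}
    (hS : ∀ M ∈ S, ∀ w, IsRational (M.space w).events (M.space w).Rel) :
    ∀ φ ∈ axC5 Φ, Valid S φ := by
  rintro _ ⟨φ, ψ, ξ, rfl⟩ M hM w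
  exact sat_imp.2 fun h => hS M hM w _ (M.measurable w φ) _ (M.measurable w ψ) _
    (M.measurable w ξ) h.1 h.2

theorem valid_of_mem_axC6 {S : Set (PlausibilityStructure.{u, v} Φ)}
    (hS : ∀ M ∈ S, ∀ w, ¬ (M.space w).Rel univ ∅) : ∀ φ ∈ axC6 Φ, Valid S φ := by
  rintro _ ⟨χ, rfl⟩ M hM w
  rw [sat_neg, sat_cond, truthSet_tru, truthSet_fls]
  exact hS M hM w

end Soundness

section SpaceSoundness

variable {Ω : Type v} {S : PlausibilitySpace Ω}

theorem PlausibilitySpace.univ_mem (S : PlausibilitySpace Ω) : univ ∈ S.events :=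
  S.isAlgebra.univ_mem

/-! ### Possibility measures -/

theorem IsPossibility.union {poss : Set Ω → unitInterval} (h : IsPossibility poss) (A B : Set Ω) :
    poss (A ∪ B) = poss A ⊔ poss B := by
  have h1 := (h.isLUB A).union (h.isLUB B)
  rw [← image_union] at h1
  exact (h.isLUB _).unique h1

theorem IsPossibility.mono {poss : Set Ω → unitInterval} (h : IsPossibility poss) {A B : Set Ω}
    (hAB : A ⊆ B) : poss A ≤ poss B := by
  rw [← union_eq_right.2 hAB, h.union]
  exact le_sup_left

/-- In a possibility space, `A → B` holds iff `A \ B` is less possible than `A`, or `A` is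
impossible. -/
theorem rel_iff_poss {poss : Set Ω → unitInterval} (h : IsPossibility poss)
    (hS : ∀ A ∈ S.events, ∀ B ∈ S.events, S.Pl A ≤ S.Pl B ↔ poss A ≤ poss B)
    {A B : Set Ω} (hA : A ∈ S.events) (hB : B ∈ S.events) :
    S.Rel A B ↔ (poss A ≠ 0 → poss (A \ B) < poss A) := by
  have hbot : S.Pl A = ⊥ ↔ poss A = 0 := by
    rw [← le_bot_iff, ← S.Pl_empty, hS _ hA _ S.isAlgebra.empty_mem, h.empty]
    exact le_bot_iff
  have hlt : S.Pl (A \ B) < S.Pl (A ∩ B) ↔ poss (A \ B) < poss (A ∩ B) := by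
    have h1 := S.isAlgebra.sdiff_mem hA hB
    have h2 := S.isAlgebra.inter_mem hA hB
    rw [lt_iff_le_not_ge, lt_iff_le_not_ge, hS _ h1 _ h2, hS _ h2 _ h1]
  have hmax : poss A = poss (A \ B) ⊔ poss (A ∩ B) := by
    rw [← h.union, sdiff_union_inter]
  have hlt' : poss (A \ B) < poss (A ∩ B) ↔ poss (A \ B) < poss A := by
    rw [hmax, lt_sup_iff]; simp
  rw [PlausibilitySpace.Rel, hbot, hlt, hlt']
  tauto

theorem ArisesFromPossibility.isPreferential (h : ArisesFromPossibility S) :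
    IsPreferential S.events S.Rel := by
  obtain ⟨poss, hp, hS⟩ := h
  have hin := fun {A B} => S.isAlgebra.inter_mem (s := A) (t := B)
  have hun := fun {A B} => S.isAlgebra.union_mem (s := A) (t := B)
  refine ⟨fun A hA => ?_, fun A hA B hB C hC h1 h2 => ?_, fun A hA B hB C hC h1 h2 => ?_,
    fun A hA B hB C hC h1 h2 => ?_, fun A hA B hB C hC h1 h2 => ?_⟩
  · rw [rel_iff_poss hp hS hA hA, Set.sdiff_self, hp.empty]
    exact fun h0 => unitInterval.pos_iff_ne_zero.2 h0
  · rw [rel_iff_poss hp hS hA (hin hB hC)]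
    rw [rel_iff_poss hp hS hA hB] at h1
    rw [rel_iff_poss hp hS hA hC] at h2
    intro h0
    rw [sdiff_inter, hp.union]
    exact sup_lt_iff.2 ⟨h1 h0, h2 h0⟩
  · rw [rel_iff_poss hp hS (hun hA hB) hC]
    rw [rel_iff_poss hp hS hA hC] at h1
    rw [rel_iff_poss hp hS hB hC] at h2
    rw [union_sdiff_distrib, hp.union, hp.union]
    intro h0
    have hAC := hp.mono (sdiff_subset : A \ C ⊆ A)
    have hBC := hp.mono (sdiff_subset : B \ C ⊆ B)
    -- For an impossible set the criterion gives no information, but that set then contributes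
    -- nothing to the maximum.
    by_cases hA0 : poss A = 0
    · by_cases hB0 : poss B = 0
      · simp [hA0, hB0] at h0
      · rw [hA0] at hAC ⊢
        have := unitInterval.pos_iff_ne_zero.2 hB0
        exact sup_lt_iff.2 ⟨lt_sup_of_lt_right (hAC.trans_lt this), lt_sup_of_lt_right (h2 hB0)⟩
    · by_cases hB0 : poss B = 0
      · rw [hB0] at hBC ⊢
        have := unitInterval.pos_iff_ne_zero.2 hA0
        exact sup_lt_iff.2 ⟨lt_sup_of_lt_left (h1 hA0), lt_sup_of_lt_left (hBC.trans_lt this)⟩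
      · exact sup_lt_iff.2 ⟨lt_sup_of_lt_left (h1 hA0), lt_sup_of_lt_right (h2 hB0)⟩
  · rw [rel_iff_poss hp hS (hin hA hB) hC]
    rw [rel_iff_poss hp hS hA hB] at h1
    rw [rel_iff_poss hp hS hA hC] at h2
    intro h0
    have hA0 : poss A ≠ 0 := fun hA0 =>
      h0 (le_bot_iff.1 ((hp.mono inter_subset_left).trans_eq hA0))
    -- The maximum defining `poss A` is not attained on `A \ B`.
    have he : poss A = poss (A ∩ B) := by
      have hmax : poss A = poss (A \ B) ⊔ poss (A ∩ B) := by rw [← hp.union, sdiff_union_inter]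
      rcases le_total (poss (A \ B)) (poss (A ∩ B)) with hle | hle
      · rwa [sup_eq_right.2 hle] at hmax
      · rw [sup_eq_left.2 hle] at hmax
        exact absurd hmax (h1 hA0).ne'
    rw [← he]
    exact (hp.mono (sdiff_subset_sdiff_left inter_subset_left)).trans_lt (h2 hA0)
  · rw [rel_iff_poss hp hS hA hC]
    rw [rel_iff_poss hp hS hA hB] at h1
    have hs : A \ C ⊆ A \ B := fun x hx => ⟨hx.1, fun hxB => hx.2 (h2 ⟨hx.1, hxB⟩)⟩
    exact fun h0 => (hp.mono hs).trans_lt (h1 h0)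

/-- By totality, failure of `A → Cᶜ` means that `A ∩ C` is as possible as `A`, so the bound on `A \
B` carries over. -/
theorem ArisesFromPossibility.isRational (h : ArisesFromPossibility S) :
    IsRational S.events S.Rel := by
  obtain ⟨poss, hp, hS⟩ := h
  intro A hA B hB C hC h1 h2
  rw [rel_iff_poss hp hS (S.isAlgebra.inter_mem hA hC) hB]
  rw [rel_iff_poss hp hS hA hB] at h1
  rw [rel_iff_poss hp hS hA (S.isAlgebra.compl_mem hC), sdiff_compl] at h2
  push Not at h2
  exact fun _ => (hp.mono (sdiff_subset_sdiff_left inter_subset_left)).trans_lt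
    ((h1 h2.1).trans_le h2.2)

theorem ArisesFromPossibility.not_rel_univ_empty (h : ArisesFromPossibility S) :
    ¬ S.Rel univ ∅ := by
  obtain ⟨poss, hp, hS⟩ := h
  rw [rel_iff_poss hp hS S.univ_mem S.isAlgebra.empty_mem, sdiff_empty, hp.univ]
  simp

/-! ### Ordinal rankings -/

/-- The order-reversing embedding `n ↦ 1 / (n + 1)`, `∞ ↦ 0` of `ℕ∞` into the unit interval. -/
noncomputable def rankToPoss : ℕ∞ → unitInterval
  | ⊤ => 0
  | (n : ℕ) => ⟨1 / ((n : ℝ) + 1), by positivity, by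
      rw [div_le_one (by positivity)]; simp⟩

theorem rankToPoss_strictAnti : StrictAnti rankToPoss := by
  intro a b hab
  induction a using ENat.recTopCoe with
  | top => exact absurd hab not_top_lt
  | coe a =>
    induction b using ENat.recTopCoe with
    | top =>
      change (0 : ℝ) < 1 / ((a : ℝ) + 1)
      positivity
    | coe b =>
      change 1 / ((b : ℝ) + 1) < 1 / ((a : ℝ) + 1)
      have : (a : ℝ) < b := by exact_mod_cast hab
      exact one_div_lt_one_div_of_lt (by positivity) (by linarith)

theorem ArisesFromRanking.arisesFromPossibility (h : ArisesFromRanking S) :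
    ArisesFromPossibility S := by
  obtain ⟨κ, hκ, hS⟩ := h
  have h0 : rankToPoss 0 = 1 := Subtype.ext (by
    change 1 / (((0 : ℕ) : ℝ) + 1) = 1
    norm_num)
  refine ⟨fun A => rankToPoss (κ A), ⟨?_, ?_, fun A => ?_⟩, fun A hA B hB => ?_⟩
  · rw [hκ.univ, h0]
  · rw [hκ.empty]; rfl
  · rcases A.eq_empty_or_nonempty with rfl | hA
    · rw [image_empty, hκ.empty]
      exact isLUB_empty
    · have := (rankToPoss_strictAnti.antitone.map_isLeast (hκ.isLeast A hA)).isLUB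
      rwa [image_image] at this
  · rw [hS A hA B hB]
    exact rankToPoss_strictAnti.le_iff_ge.symm

end SpaceSoundness

/-! ### Parameterized probability distributions -/

section PPD

variable {Ω : Type v} {S : PlausibilitySpace Ω}

namespace IsProbability

variable {F : Set (Set Ω)} {μ : Set Ω → ℝ}

theorem nonneg (h : IsProbability F μ) {A : Set Ω} (hA : A ∈ F) : 0 ≤ μ A := (h.mem_Icc A hA).1

theorem inter_add_sdiff (h : IsProbability F μ) (hF : MeasureTheory.IsSetAlgebra F) {A B : Set Ω}
    (hA : A ∈ F) (hB : B ∈ F) : μ (A ∩ B) + μ (A \ B) = μ A := by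
  rw [← h.add _ (hF.inter_mem hA hB) _ (hF.sdiff_mem hA hB) disjoint_inf_sdiff, inter_union_sdiff]

theorem mono (h : IsProbability F μ) (hF : MeasureTheory.IsSetAlgebra F) {A B : Set Ω}
    (hA : A ∈ F) (hB : B ∈ F) (hAB : A ⊆ B) : μ A ≤ μ B := by
  have h1 := h.inter_add_sdiff hF hB hA
  rw [inter_eq_right.2 hAB] at h1
  linarith [h.nonneg (hF.sdiff_mem hB hA)]

theorem union_le (h : IsProbability F μ) (hF : MeasureTheory.IsSetAlgebra F) {A B : Set Ω}
    (hA : A ∈ F) (hB : B ∈ F) : μ (A ∪ B) ≤ μ A + μ B := by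
  have h1 := h.inter_add_sdiff hF (hF.union_mem hA hB) hA
  rw [union_inter_cancel_left, union_sdiff_left] at h1
  linarith [h.mono hF (hF.sdiff_mem hB hA) hB sdiff_subset]

theorem condProb_le_one (h : IsProbability F μ) (hF : MeasureTheory.IsSetAlgebra F) {A B : Set Ω}
    (hA : A ∈ F) (hB : B ∈ F) : condProb μ B A ≤ 1 := by
  unfold condProb
  split_ifs with h0
  · rfl
  · have := lt_of_le_of_ne (h.nonneg hA) (Ne.symm h0)
    rw [div_le_one this]
    exact h.mono hF (hF.inter_mem hB hA) hA inter_subset_right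

theorem one_sub_le_condProb_iff (h : IsProbability F μ) (hF : MeasureTheory.IsSetAlgebra F)
    {A B : Set Ω} (hA : A ∈ F) (hB : B ∈ F) {δ : ℝ} (hδ : 0 ≤ δ) :
    1 - δ ≤ condProb μ B A ↔ μ (A \ B) ≤ δ * μ A := by
  have h1 := h.inter_add_sdiff hF hA hB
  have h2 := h.nonneg (hF.sdiff_mem hA hB)
  have h3 := h.nonneg (hF.inter_mem hA hB)
  unfold condProb
  split_ifs with h0
  · rw [h0]
    constructor
    · intro; linarith
    · intro; linarith
  · have := lt_of_le_of_ne (h.nonneg hA) (Ne.symm h0)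
    rw [le_div_iff₀ this, inter_comm]
    constructor
    · intro; linarith
    · intro; linarith

end IsProbability

/-- `lim Prᵢ(B | A) = 1` in terms of unconditional probabilities. -/
theorem tendsto_condProb_iff {F : Set (Set Ω)} (hF : MeasureTheory.IsSetAlgebra F)
    {Pr : ℕ → Set Ω → ℝ} (hPr : ∀ i, IsProbability F (Pr i)) {A B : Set Ω} (hA : A ∈ F)
    (hB : B ∈ F) : Tendsto (fun i => condProb (Pr i) B A) atTop (𝓝 1) ↔
      ∀ δ > 0, ∀ᶠ i in atTop, Pr i (A \ B) ≤ δ * Pr i A := by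
  have key : ∀ i δ, 0 < δ → (1 - δ ≤ condProb (Pr i) B A ↔ Pr i (A \ B) ≤ δ * Pr i A) :=
    fun i δ hδ => (hPr i).one_sub_le_condProb_iff hF hA hB hδ.le
  constructor
  · intro h δ hδ
    filter_upwards [h.eventually (lt_mem_nhds (show 1 - δ < 1 by linarith))] with i hi
    exact (key i δ hδ).1 hi.le
  · intro h
    rw [tendsto_order]
    refine ⟨fun a ha => ?_, fun a ha => Eventually.of_forall fun i =>
      ((hPr i).condProb_le_one hF hA hB).trans_lt ha⟩
    filter_upwards [h ((1 - a) / 2) (by linarith)] with i hi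
    have := (key i ((1 - a) / 2) (by linarith)).2 hi
    linarith

theorem rel_iff_ppd {Pr : ℕ → Set Ω → ℝ} (hPr : ∀ i, IsProbability S.events (Pr i))
    (hS : ∀ A ∈ S.events, ∀ B ∈ S.events,
      S.Pl A ≤ S.Pl B ↔ Tendsto (fun i => condProb (Pr i) B (A ∪ B)) atTop (𝓝 1))
    {A B : Set Ω} (hA : A ∈ S.events) (hB : B ∈ S.events) :
    S.Rel A B ↔ ∀ δ > 0, ∀ᶠ i in atTop, Pr i (A \ B) ≤ δ * Pr i A := by
  have hAB := S.isAlgebra.inter_mem hA hB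
  have hAdB := S.isAlgebra.sdiff_mem hA hB
  have h1 : S.Pl (A \ B) ≤ S.Pl (A ∩ B) ↔ ∀ δ > 0, ∀ᶠ i in atTop, Pr i (A \ B) ≤ δ * Pr i A := by
    rw [hS _ hAdB _ hAB, sdiff_union_inter, tendsto_condProb_iff S.isAlgebra hPr hA hAB,
      sdiff_self_inter]
  have h2 : S.Pl (A ∩ B) ≤ S.Pl (A \ B) ↔ ∀ δ > 0, ∀ᶠ i in atTop, Pr i (A ∩ B) ≤ δ * Pr i A := by
    rw [hS _ hAB _ hAdB, inter_union_sdiff, tendsto_condProb_iff S.isAlgebra hPr hA hAdB,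
      Set.sdiff_sdiff_right_self]
  -- Taking `δ < 1`, this says that `A` eventually has probability zero.
  have h3 : S.Pl A = ⊥ ↔ ∀ δ > 0, ∀ᶠ i in atTop, Pr i A ≤ δ * Pr i A := by
    rw [← le_bot_iff, ← S.Pl_empty, hS _ hA _ S.isAlgebra.empty_mem, union_empty,
      tendsto_condProb_iff S.isAlgebra hPr hA S.isAlgebra.empty_mem, sdiff_empty]
  have hadd := fun i => (hPr i).inter_add_sdiff S.isAlgebra hA hB
  have hn1 := fun i => (hPr i).nonneg hAB
  have hn2 := fun i => (hPr i).nonneg hAdB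
  rw [PlausibilitySpace.Rel, lt_iff_le_not_ge, h1, h2, h3]
  constructor
  · rintro (h | h)
    · intro δ hδ
      filter_upwards [h δ hδ] with i hi
      linarith [hadd i, hn1 i]
    · exact h.1
  · intro h
    -- If strictness fails, both parts of `A` have vanishing share in `A`; adding the two bounds
    -- with `δ / 2` shows that `A` itself is at the bottom.
    refine or_iff_not_imp_right.2 fun hn δ hδ => ?_
    have h' : ∀ δ > 0, ∀ᶠ i in atTop, Pr i (A ∩ B) ≤ δ * Pr i A := by
      by_contra hc
      exact hn ⟨h, hc⟩
    filter_upwards [h (δ / 2) (by linarith), h' (δ / 2) (by linarith)] with i hi hi'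
    linarith [hadd i]

theorem ArisesFromPPD.isPreferential (h : ArisesFromPPD S) : IsPreferential S.events S.Rel := by
  obtain ⟨Pr, hPr, hS⟩ := h
  have hF := S.isAlgebra
  have hsd := fun {A B} => S.isAlgebra.sdiff_mem (s := A) (t := B)
  have hin := fun {A B} => S.isAlgebra.inter_mem (s := A) (t := B)
  have hun := fun {A B} => S.isAlgebra.union_mem (s := A) (t := B)
  refine ⟨fun A hA => ?_, fun A hA B hB C hC h1 h2 => ?_, fun A hA B hB C hC h1 h2 => ?_,
    fun A hA B hB C hC h1 h2 => ?_, fun A hA B hB C hC h1 h2 => ?_⟩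
  · rw [rel_iff_ppd hPr hS hA hA]
    refine fun δ hδ => Eventually.of_forall fun i => ?_
    rw [Set.sdiff_self, (hPr i).empty]
    exact mul_nonneg hδ.le ((hPr i).nonneg hA)
  · rw [rel_iff_ppd hPr hS hA (hin hB hC)]
    rw [rel_iff_ppd hPr hS hA hB] at h1
    rw [rel_iff_ppd hPr hS hA hC] at h2
    intro δ hδ
    filter_upwards [h1 (δ / 2) (by linarith), h2 (δ / 2) (by linarith)] with i hi hi'
    rw [sdiff_inter]
    linarith [(hPr i).union_le hF (hsd hA hB) (hsd hA hC)]
  · rw [rel_iff_ppd hPr hS (hun hA hB) hC]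
    rw [rel_iff_ppd hPr hS hA hC] at h1
    rw [rel_iff_ppd hPr hS hB hC] at h2
    intro δ hδ
    filter_upwards [h1 (δ / 2) (by linarith), h2 (δ / 2) (by linarith)] with i hi hi'
    rw [union_sdiff_distrib]
    have e1 := mul_le_mul_of_nonneg_left
      ((hPr i).mono hF hA (hun hA hB) subset_union_left) (show 0 ≤ δ / 2 by linarith)
    have e2 := mul_le_mul_of_nonneg_left
      ((hPr i).mono hF hB (hun hA hB) subset_union_right) (show 0 ≤ δ / 2 by linarith)
    linarith [(hPr i).union_le hF (hsd hA hC) (hsd hB hC)]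
  · rw [rel_iff_ppd hPr hS (hin hA hB) hC]
    rw [rel_iff_ppd hPr hS hA hB] at h1
    rw [rel_iff_ppd hPr hS hA hC] at h2
    intro δ hδ
    -- The bound `1 / 2` gives `Pr A ≤ 2 * Pr (A ∩ B)`, so a `δ / 2` share of `A` is at most a `δ`
    -- share of `A ∩ B`.
    filter_upwards [h1 (1 / 2) (by norm_num), h2 (δ / 2) (by linarith)] with i hi hi'
    have e1 := (hPr i).inter_add_sdiff hF hA hB
    have e2 := (hPr i).mono hF (hsd (hin hA hB) hC) (hsd hA hC)
      (sdiff_subset_sdiff_left inter_subset_left)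
    have e3 := mul_le_mul_of_nonneg_left
      (show Pr i A ≤ 2 * Pr i (A ∩ B) by linarith) (show 0 ≤ δ / 2 by linarith)
    linarith
  · rw [rel_iff_ppd hPr hS hA hC]
    rw [rel_iff_ppd hPr hS hA hB] at h1
    intro δ hδ
    filter_upwards [h1 δ hδ] with i hi
    exact ((hPr i).mono hF (hsd hA hC) (hsd hA hB) fun x hx =>
      ⟨hx.1, fun hxB => hx.2 (h2 ⟨hx.1, hxB⟩)⟩).trans hi

theorem ArisesFromPPD.not_rel_univ_empty (h : ArisesFromPPD S) : ¬ S.Rel univ ∅ := by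
  obtain ⟨Pr, hPr, hS⟩ := h
  rw [rel_iff_ppd hPr hS S.univ_mem S.isAlgebra.empty_mem]
  intro h
  obtain ⟨i, hi⟩ := (h (1 / 2) (by norm_num)).exists
  rw [sdiff_empty, (hPr i).univ] at hi
  norm_num at hi

end PPD

/-! ### Plausibility spaces from rankings of points -/

section RankSpace

variable {Ω : Type v}

/-- The rank of a set: the least rank of its points. -/
noncomputable def setRank (k : Ω → ℕ∞) (A : Set Ω) : ℕ∞ := sInf (k '' A)

theorem setRank_le {k : Ω → ℕ∞} {A : Set Ω} {x : Ω} (hx : x ∈ A) : setRank k A ≤ k x :=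
  sInf_le (mem_image_of_mem k hx)

theorem exists_eq_setRank (k : Ω → ℕ∞) {A : Set Ω} (hA : A.Nonempty) :
    ∃ x ∈ A, k x = setRank k A := csInf_mem (hA.image k)

theorem setRank_lt_iff {k : Ω → ℕ∞} {A : Set Ω} {n : ℕ∞} : setRank k A < n ↔ ∃ x ∈ A, k x < n := by
  rw [setRank, sInf_lt_iff, exists_mem_image]

theorem setRank_empty (k : Ω → ℕ∞) : setRank k ∅ = ⊤ := by rw [setRank, image_empty, sInf_empty]

theorem setRank_univ {k : Ω → ℕ∞} (h : ∃ x, k x = 0) : setRank k univ = 0 := by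
  obtain ⟨x, hx⟩ := h
  exact le_bot_iff.1 ((setRank_le (mem_univ x)).trans_eq hx)

theorem setRank_anti (k : Ω → ℕ∞) {A B : Set Ω} (h : A ⊆ B) : setRank k B ≤ setRank k A :=
  sInf_le_sInf (image_mono h)

theorem setRank_singleton (k : Ω → ℕ∞) (x : Ω) : setRank k {x} = k x := by
  rw [setRank, image_singleton, sInf_singleton]

theorem rankHolds_iff (k : Ω → ℕ∞) (A B : Set Ω) :
    RankHolds k A B ↔ setRank k A = ⊤ ∨ setRank k (A ∩ B) < setRank k (A \ B) := by
  constructor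
  · refine fun h => or_iff_not_imp_left.2 fun hA => ?_
    by_contra! hle
    obtain ⟨x, hxA, hx⟩ := setRank_lt_iff.1 (lt_top_iff_ne_top.2 hA)
    have hne : setRank k (A \ B) < ⊤ := by
      by_cases hxB : x ∈ B
      · exact hle.trans_lt (setRank_lt_iff.2 ⟨x, ⟨hxA, hxB⟩, hx⟩)
      · exact setRank_lt_iff.2 ⟨x, ⟨hxA, hxB⟩, hx⟩
    obtain ⟨z, hz, -⟩ := setRank_lt_iff.1 hne
    obtain ⟨z, hz, hz'⟩ := exists_eq_setRank k ⟨z, hz⟩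
    obtain ⟨y, hyA, hyB, hy⟩ := h z hz.1 hz.2 (hz' ▸ hne)
    exact (hz' ▸ hy).not_ge (hle.trans (setRank_le ⟨hyA, hyB⟩))
  · rintro (h | h) x hxA hxB hx
    · exact absurd (setRank_lt_iff.2 ⟨x, hxA, hx⟩) (by simp [h])
    · obtain ⟨y, hy, hy'⟩ := setRank_lt_iff.1 (h.trans_le (setRank_le ⟨hxA, hxB⟩))
      exact ⟨y, hy.1, hy.2, hy'⟩

/-- The plausibility space in which `A` is at most as plausible as `B` iff every ranking of a family
gives `B` a rank that is at most the rank of `A`. -/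
noncomputable def rankSpace {J : Type v} (k : J → Ω → ℕ∞) (hk : ∀ j, ∃ x, k j x = 0) :
    PlausibilitySpace Ω where
  events := univ
  isAlgebra := ⟨trivial, fun _ _ => trivial, fun _ _ _ _ => trivial⟩
  Val := J → ℕ∞ᵒᵈ
  Pl A j := OrderDual.toDual (setRank (k j) A)
  Pl_univ := funext fun j => congrArg OrderDual.toDual (setRank_univ (hk j))
  Pl_empty := funext fun j => congrArg OrderDual.toDual (setRank_empty (k j))
  Pl_mono _ _ _ _ h j := setRank_anti (k j) h

variable {J : Type v} {k : J → Ω → ℕ∞} {hk : ∀ j, ∃ x, k j x = 0}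

theorem rankSpace_le_iff {A B : Set Ω} : (rankSpace k hk).Pl A ≤ (rankSpace k hk).Pl B ↔
    ∀ j, setRank (k j) B ≤ setRank (k j) A := Iff.rfl

theorem rankSpace_eq_bot_iff {A : Set Ω} : (rankSpace k hk).Pl A = ⊥ ↔
    ∀ j, setRank (k j) A = ⊤ := funext_iff

theorem rankSpace_rel_iff {A B : Set Ω} : (rankSpace k hk).Rel A B ↔
    (∀ j, setRank (k j) A = ⊤) ∨ (∀ j, setRank (k j) (A ∩ B) ≤ setRank (k j) (A \ B)) ∧
      ∃ j, setRank (k j) (A ∩ B) < setRank (k j) (A \ B) := by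
  rw [PlausibilitySpace.Rel, rankSpace_eq_bot_iff, lt_iff_le_not_ge, rankSpace_le_iff,
    rankSpace_le_iff, not_forall]
  simp only [not_le]

theorem rankSpace_rel_iff_of_unique [Unique J] {A B : Set Ω} :
    (rankSpace k hk).Rel A B ↔ RankHolds (k default) A B := by
  rw [rankSpace_rel_iff, rankHolds_iff, Unique.forall_iff, Unique.forall_iff, Unique.exists_iff]
  exact or_congr_right ⟨fun h => h.2, fun h => ⟨h.le, h⟩⟩

theorem arisesFromRanking_rankSpace [Unique J] : ArisesFromRanking (rankSpace k hk) := by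
  refine ⟨setRank (k default), ⟨setRank_univ (hk default), setRank_empty _, fun A hA => ?_⟩,
    fun A _ B _ => by rw [rankSpace_le_iff, Unique.forall_iff]⟩
  simp only [setRank_singleton]
  obtain ⟨x, hx, hx'⟩ := exists_eq_setRank (k default) hA
  exact ⟨⟨x, hx, hx'⟩, fun n ⟨y, hy, hn⟩ => hn ▸ setRank_le hy⟩

/-- Disjoint sets cannot share a point of least finite rank, so ties occur only at `⊤`, where the
inequality with `+ 1` remains true. -/
theorem IsLinearRanking.setRank_add_one_le {k : Ω → ℕ∞} (h : IsLinearRanking k) {A B : Set Ω}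
    (hAB : Disjoint A B) (hle : setRank k B ≤ setRank k A) : setRank k B + 1 ≤ setRank k A := by
  by_cases htop : setRank k A = ⊤
  · rw [htop]; exact le_top
  replace htop := lt_top_iff_ne_top.2 htop
  refine Order.add_one_le_of_lt (lt_of_le_of_ne hle fun he => ?_)
  obtain ⟨x, hx, -⟩ := setRank_lt_iff.1 htop
  obtain ⟨x, hx, hx'⟩ := exists_eq_setRank k ⟨x, hx⟩
  obtain ⟨y, hy, -⟩ := setRank_lt_iff.1 (hle.trans_lt htop)
  obtain ⟨y, hy, hy'⟩ := exists_eq_setRank k ⟨y, hy⟩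
  have hxy : x = y := h x y (by rw [hx', hy', he]) (hx' ▸ htop)
  exact hAB.le_bot ⟨hx, hxy ▸ hy⟩

/-- Strictness in the product order asks for only one strict coordinate. Linearity upgrades every
other coordinate: a tie between `A ∩ B` and `A \ B` forces rank `⊤` for `A`, where the conditional
is vacuous. -/
theorem rankSpace_rel_iff_of_isLinearRanking (h : ∀ j, IsLinearRanking (k j)) {A B : Set Ω} :
    (rankSpace k hk).Rel A B ↔ ∀ j, RankHolds (k j) A B := by
  simp only [rankSpace_rel_iff, rankHolds_iff]
  constructor
  · rintro (h1 | ⟨h1, -⟩) j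
    · exact Or.inl (h1 j)
    · refine or_iff_not_imp_left.2 fun hA => ?_
      have h2 := (h j).setRank_add_one_le
        (disjoint_sdiff_left.mono_right inter_subset_right) (h1 j)
      refine lt_of_le_of_ne (h1 j) fun he => ?_
      rw [← he] at h2
      have h3 : setRank (k j) (A ∩ B) = ⊤ := by
        by_contra hne
        exact (ENat.add_one_le_iff hne).1 h2 |>.false
      refine hA ((eq_top_iff).2 (le_of_not_gt fun hlt => ?_))
      obtain ⟨x, hxA, hx⟩ := setRank_lt_iff.1 hlt
      by_cases hxB : x ∈ B
      · exact (setRank_lt_iff.2 ⟨x, ⟨hxA, hxB⟩, hx⟩ : setRank (k j) (A ∩ B) < ⊤).ne h3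
      · exact (setRank_lt_iff.2 ⟨x, ⟨hxA, hxB⟩, hx⟩ : setRank (k j) (A \ B) < ⊤).ne (he ▸ h3)
  · intro h1
    by_cases hall : ∀ j, setRank (k j) A = ⊤
    · exact Or.inl hall
    · obtain ⟨j, hj⟩ := not_forall.1 hall
      refine Or.inr ⟨fun j => ?_, j, (h1 j).resolve_left hj⟩
      rcases h1 j with h2 | h2
      · exact le_top.trans (h2.symm.trans_le (setRank_anti _ sdiff_subset))
      · exact h2.le

/-! ### Interleaving rankings into a parameterized probability distribution -/

/-- The power `ε ^ n`, with `ε ^ ∞ = 0`. -/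
noncomputable def rankWeight (ε : ℝ) (n : ℕ∞) : ℝ := if n = ⊤ then 0 else ε ^ n.toNat

section

variable {ε : ℝ}

theorem rankWeight_pos (hε : 0 < ε) {n : ℕ∞} (hn : n ≠ ⊤) : 0 < rankWeight ε n := by
  rw [rankWeight, if_neg hn]; positivity

theorem rankWeight_nonneg (hε : 0 < ε) (n : ℕ∞) : 0 ≤ rankWeight ε n := by
  unfold rankWeight; split_ifs <;> positivity

theorem rankWeight_anti (hε : 0 < ε) (hε1 : ε ≤ 1) {m n : ℕ∞} (h : m ≤ n) :
    rankWeight ε n ≤ rankWeight ε m := by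
  by_cases hn : n = ⊤
  · rw [hn, rankWeight, if_pos rfl]; exact rankWeight_nonneg hε m
  · rw [rankWeight, if_neg hn, rankWeight, if_neg (ne_top_of_le_ne_top hn h)]
    exact pow_le_pow_of_le_one hε.le hε1 (ENat.toNat_le_toNat h hn)

theorem rankWeight_add_one (n : ℕ∞) : rankWeight ε (n + 1) = ε * rankWeight ε n := by
  by_cases hn : n = ⊤
  · simp [rankWeight, hn]
  · rw [rankWeight, if_neg (by simpa using hn), rankWeight, if_neg hn,
      ENat.toNat_add hn (by simp), ENat.toNat_one, pow_succ']

variable [Fintype Ω]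

open Classical in
/-- The total weight of the points of a set. -/
noncomputable def mass (k : Ω → ℕ∞) (ε : ℝ) (A : Set Ω) : ℝ :=
  ∑ x, if x ∈ A then rankWeight ε (k x) else 0

variable {k : Ω → ℕ∞}

theorem mass_empty : mass k ε ∅ = 0 := by simp [mass]

theorem mass_union {A B : Set Ω} (h : Disjoint A B) :
    mass k ε (A ∪ B) = mass k ε A + mass k ε B := by
  rw [mass, mass, mass, ← Finset.sum_add_distrib]
  refine Finset.sum_congr rfl fun x _ => ?_
  have : x ∈ A → x ∉ B := fun hA hB => h.le_bot ⟨hA, hB⟩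
  by_cases hA : x ∈ A
  · simp [hA, this hA]
  · have hAB : x ∈ A ∪ B ↔ x ∈ B := or_iff_right hA
    rw [if_neg hA, zero_add]
    by_cases hB : x ∈ B
    · rw [if_pos hB, if_pos (hAB.2 hB)]
    · rw [if_neg hB, if_neg (mt hAB.1 hB)]

theorem mass_nonneg (hε : 0 < ε) (A : Set Ω) : 0 ≤ mass k ε A :=
  Finset.sum_nonneg fun x _ => by
    split_ifs
    · exact rankWeight_nonneg hε _
    · exact le_rfl

theorem mass_mono (hε : 0 < ε) {A B : Set Ω} (h : A ⊆ B) : mass k ε A ≤ mass k ε B := by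
  rw [← union_sdiff_cancel h, mass_union disjoint_sdiff_right]
  exact le_add_of_nonneg_right (mass_nonneg hε _)

theorem rankWeight_setRank_le_mass (hε : 0 < ε) (A : Set Ω) :
    rankWeight ε (setRank k A) ≤ mass k ε A := by
  rcases A.eq_empty_or_nonempty with rfl | hA
  · rw [setRank_empty, mass_empty, rankWeight, if_pos rfl]
  obtain ⟨x, hx, hx'⟩ := exists_eq_setRank k hA
  refine le_trans (le_of_eq ?_) (Finset.single_le_sum (fun y _ => ?_) (Finset.mem_univ x))
  · rw [if_pos hx, hx']
  · split_ifs
    · exact rankWeight_nonneg hε _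
    · exact le_rfl

theorem mass_le (hε : 0 < ε) (hε1 : ε ≤ 1) (A : Set Ω) :
    mass k ε A ≤ Fintype.card Ω * rankWeight ε (setRank k A) := by
  rw [← nsmul_eq_mul]
  refine Finset.sum_le_card_nsmul _ _ _ fun x _ => ?_
  split_ifs with hx
  · exact rankWeight_anti hε hε1 (setRank_le hx)
  · exact rankWeight_nonneg hε _

/-- By linearity `A \ B` ranks at least one level after `B`, which gains a factor `ε`. -/
theorem IsLinearRanking.mass_sdiff_le (hk : IsLinearRanking k) (hε : 0 < ε) (hε1 : ε ≤ 1)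
    {A B : Set Ω} (h : setRank k B ≤ setRank k A) :
    mass k ε (A \ B) ≤ Fintype.card Ω * ε * mass k ε (A ∪ B) := by
  have h1 := hk.setRank_add_one_le disjoint_sdiff_left (h.trans (setRank_anti k sdiff_subset))
  calc mass k ε (A \ B) ≤ Fintype.card Ω * rankWeight ε (setRank k (A \ B)) := mass_le hε hε1 _
    _ ≤ Fintype.card Ω * rankWeight ε (setRank k B + 1) := by
      gcongr; exact rankWeight_anti hε hε1 h1
    _ = Fintype.card Ω * ε * rankWeight ε (setRank k B) := by rw [rankWeight_add_one]; ring
    _ ≤ Fintype.card Ω * ε * mass k ε (A ∪ B) := by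
      gcongr
      exact (rankWeight_setRank_le_mass hε B).trans (mass_mono hε subset_union_right)

/-- A point of least rank in `A ∪ B` lies in `A \ B` and outweighs or equals every other point, so
`A \ B` keeps a share bounded below independently of `ε`. -/
theorem mass_union_le (hε : 0 < ε) (hε1 : ε ≤ 1) {A B : Set Ω} (h : setRank k A < setRank k B) :
    0 < mass k ε (A ∪ B) ∧ mass k ε (A ∪ B) ≤ Fintype.card Ω * mass k ε (A \ B) := by
  have htop : setRank k A < ⊤ := h.trans_le le_top
  obtain ⟨x, hx, -⟩ := setRank_lt_iff.1 htop
  obtain ⟨x, hx, hx'⟩ := exists_eq_setRank k ⟨x, hx⟩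
  have hxB : x ∉ B := fun hxB => (h.trans_le (setRank_le hxB)).ne hx'.symm
  have hle : setRank k (A \ B) ≤ setRank k (A ∪ B) := by
    refine le_sInf ?_
    rintro _ ⟨y, hy, rfl⟩
    refine (setRank_le (show x ∈ A \ B from ⟨hx, hxB⟩)).trans (hx'.trans_le ?_)
    rcases hy with hy | hy
    · exact setRank_le hy
    · exact h.le.trans (setRank_le hy)
  constructor
  · exact (rankWeight_pos hε htop.ne).trans_le
      ((rankWeight_setRank_le_mass hε A).trans (mass_mono hε subset_union_left))
  · refine (mass_le hε hε1 _).trans ?_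
    gcongr
    exact (rankWeight_anti hε hε1 hle).trans (rankWeight_setRank_le_mass hε _)

theorem mass_univ_pos (hε : 0 < ε) (hk : ∃ x, k x = 0) : 0 < mass k ε univ := by
  refine lt_of_lt_of_le (rankWeight_pos hε ?_) (rankWeight_setRank_le_mass hε univ)
  rw [setRank_univ hk]
  exact ENat.zero_ne_top

theorem isProbability_mass (hε : 0 < ε) (hk : ∃ x, k x = 0) (F : Set (Set Ω)) :
    IsProbability F fun A => mass k ε A / mass k ε univ where
  mem_Icc A _ := ⟨div_nonneg (mass_nonneg hε _) (mass_nonneg hε _),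
    (div_le_one (mass_univ_pos hε hk)).2 (mass_mono hε (subset_univ A))⟩
  empty := by rw [mass_empty, zero_div]
  univ := div_self (mass_univ_pos hε hk).ne'
  add A _ B _ h := by rw [mass_union h, add_div]

end

theorem exists_frequently_eq (J : Type v) [Countable J] [Nonempty J] :
    ∃ e : ℕ → J, ∀ j, ∃ᶠ i in atTop, e i = j := by
  obtain ⟨f, hf⟩ := exists_surjective_nat J
  refine ⟨fun i => f i.unpair.1, fun j => frequently_atTop.2 fun n => ?_⟩
  obtain ⟨a, rfl⟩ := hf j
  exact ⟨Nat.pair a n, Nat.right_le_pair a n, by simp⟩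

theorem arisesFromPPD_rankSpace [Finite Ω] [Countable J] [Nonempty J]
    (h : ∀ j, IsLinearRanking (k j)) : ArisesFromPPD (rankSpace k hk) := by
  have := Fintype.ofFinite Ω
  obtain ⟨e, he⟩ := exists_frequently_eq J
  have : Nonempty Ω := (hk (Classical.arbitrary J)).nonempty
  have hN : (0 : ℝ) < Fintype.card Ω := by exact_mod_cast Fintype.card_pos
  let ε : ℕ → ℝ := fun i => 1 / ((i : ℝ) + 1)
  have hε : ∀ i, 0 < ε i := fun i => by positivity
  have hε1 : ∀ i, ε i ≤ 1 := fun i => by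
    rw [div_le_one (by positivity)]; simp
  have hPr : ∀ i, IsProbability (rankSpace k hk).events
      fun A => mass (k (e i)) (ε i) A / mass (k (e i)) (ε i) univ :=
    fun i => isProbability_mass (hε i) (hk _) _
  refine ⟨_, hPr, fun A _ B _ => ?_⟩
  rw [tendsto_condProb_iff (rankSpace k hk).isAlgebra hPr trivial trivial, rankSpace_le_iff]
  have hdiv : ∀ i δ, mass (k (e i)) (ε i) ((A ∪ B) \ B) / mass (k (e i)) (ε i) univ ≤
      δ * (mass (k (e i)) (ε i) (A ∪ B) / mass (k (e i)) (ε i) univ) ↔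
      mass (k (e i)) (ε i) (A \ B) ≤ δ * mass (k (e i)) (ε i) (A ∪ B) := fun i δ => by
    rw [union_sdiff_right, ← mul_div_assoc, div_le_div_iff_of_pos_right (mass_univ_pos (hε i) (hk _))]
  simp only [hdiv]
  constructor
  · intro hle δ hδ
    have hlim : Tendsto ε atTop (𝓝 0) := tendsto_one_div_add_atTop_nhds_zero_nat
    filter_upwards [hlim.eventually (gt_mem_nhds (div_pos hδ hN))] with i hi
    refine ((h _).mass_sdiff_le (hε i) (hε1 i) (hle (e i))).trans ?_
    refine mul_le_mul_of_nonneg_right ?_ (mass_nonneg (hε i) _)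
    rw [lt_div_iff₀ hN] at hi
    linarith
  · intro hev j
    by_contra! hlt
    -- At an index where ranking `j` is used, this `δ` bounds the mass of `A ∪ B` by half of itself,
    -- although it is positive.
    obtain ⟨i, rfl, hi⟩ := ((he j).and_eventually
      (hev (1 / (2 * Fintype.card Ω)) (by positivity))).exists
    obtain ⟨h1, h2⟩ := mass_union_le (hε i) (hε1 i) hlt
    have h3 := mul_le_mul_of_nonneg_left hi hN.le
    have h4 : (Fintype.card Ω : ℝ) * (1 / (2 * Fintype.card Ω) * mass (k (e i)) (ε i) (A ∪ B)) =
        mass (k (e i)) (ε i) (A ∪ B) / 2 := by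
      field_simp
    linarith

/-! ### Representation of preferential relations -/

variable {r : Set Ω → Set Ω → Prop}

theorem IsPreferential.exists_arisesFromPPD [Finite Ω] (h : IsPreferential Set.univ r)
    (h0 : ¬ r univ ∅) : ∃ S : PlausibilitySpace Ω, ArisesFromPPD S ∧ S.events = univ ∧
      ∀ A B, S.Rel A B ↔ r A B := by
  -- One refuting linear ranking for each failing conditional; normality ensures that there is at
  -- least one.
  let J : Type v := {p : Set Ω × Set Ω // ¬ r p.1 p.2}
  have : Nonempty J := ⟨⟨(univ, ∅), h0⟩⟩
  choose k hk hk0 hkr hkn using fun j : J => h.exists_linear_ranking_not j.2 univ (subset_univ _)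
  refine ⟨rankSpace k hk0, arisesFromPPD_rankSpace hk, rfl, fun A B => ?_⟩
  rw [rankSpace_rel_iff_of_isLinearRanking hk]
  refine ⟨fun hall => ?_, fun hr j => hkr j A (subset_univ _) B hr⟩
  by_contra hn
  exact hkn ⟨(A, B), hn⟩ (hall _)

theorem IsPreferential.exists_arisesFromRanking [Finite Ω] (h : IsPreferential Set.univ r)
    (hr : IsRational Set.univ r) (h0 : ¬ r univ ∅) :
    ∃ S : PlausibilitySpace Ω, ArisesFromRanking S ∧ S.events = univ ∧
      ∀ A B, S.Rel A B ↔ r A B := by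
  obtain ⟨k, hk0, hk⟩ := h.exists_ranking hr univ
  refine ⟨rankSpace (J := PUnit) (fun _ => k) fun _ => hk0 h0, arisesFromRanking_rankSpace, rfl,
    fun A B => ?_⟩
  rw [rankSpace_rel_iff_of_unique, hk A (subset_univ _)]

end RankSpace

/-! ### Completeness -/

section Completeness

variable {Φ : Type u} {Ax : Set (Form Φ)}

/-- The shared canonical model construction: only `hQ`, the representation of relations on finite
sets, depends on the class. -/
theorem complete_of_representation (h6 : axC6 Φ ⊆ Ax)
    (Q : ∀ {Ω : Type v}, PlausibilitySpace Ω → Prop)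
    (hQ : ∀ (Ω : Type v) [Finite Ω] (r : Set Ω → Set Ω → Prop), IsPreferential Set.univ r →
      (axC5 Φ ⊆ Ax → IsRational Set.univ r) → ¬ r univ ∅ →
      ∃ S : PlausibilitySpace Ω, Q S ∧ S.events = univ ∧ ∀ A B, S.Rel A B ↔ r A B) :
    Complete Ax {M : PlausibilityStructure.{u, v} Φ | ∀ w, Q (M.space w)} := by
  intro φ₀ hvalid
  refine provable_of_forall_isModel fun m₀ hm₀ => ?_
  obtain ⟨n, m, hm, hex⟩ := exists_finite_models Ax (finite_subformulas φ₀)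
  have : Nonempty (Form Φ) := ⟨φ₀⟩
  let W : Type v := ULift (Fin n)
  let D : Set W := univ
  have hdef : ∀ A : Set D, Definable Ax fun m' =>
      ∃ x ∈ A, ∀ α ∈ subformulas φ₀, (m' α ↔ m x.1.down α) := fun A =>
    Definable.exists_mem A.toFinite fun x _ =>
      Definable.forall_mem (finite_subformulas φ₀) fun α _ => Definable.iff_const α _
  choose χ hχ using hdef
  -- Every model matches exactly one world on the subformulas, and `χ A` says that this world is in
  -- `A`; Boolean identities between sets thus become provable equivalences.
  have hidx : ∀ m', IsModel Ax m' → ∃ x : D, (∀ α ∈ subformulas φ₀, (m' α ↔ m x.1.down α)) ∧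
      ∀ A, m' (χ A) ↔ x ∈ A := by
    intro m' hm'
    obtain ⟨i, hi, huniq⟩ := hex m' hm'
    refine ⟨⟨⟨i⟩, trivial⟩, hi, fun A => ?_⟩
    rw [hχ A m' hm']
    refine ⟨?_, fun h => ⟨_, h, hi⟩⟩
    rintro ⟨x, hx, hx'⟩
    have : x = ⟨⟨i⟩, trivial⟩ := Subtype.ext (ULift.ext _ _ (huniq _ hx'))
    exact this ▸ hx
  -- These conditionals need not be subformulas of `φ₀`, so each world carries a full maximal theory
  -- and not just a truth pattern.
  let r : W → Set D → Set D → Prop := fun w A B => m w.down (cond (χ A) (χ B))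
  have hpref : ∀ w, IsPreferential Set.univ (r w) := by
    intro w
    have hw := hm w.down
    refine ⟨fun A _ => hw.provable _ (.C1 _), fun A _ B _ C _ h1 h2 => ?_,
      fun A _ B _ C _ h1 h2 => ?_, fun A _ B _ C _ h1 h2 => ?_, fun A _ B _ C _ h1 h2 => ?_⟩
    · have h3 := (hw.imp _ _).1 (hw.provable _ (.C2 (χ A) (χ B) (χ C))) ((hw.and _ _).2 ⟨h1, h2⟩)
      refine (hw.cond_congr_right fun m' hm' => ?_).1 h3
      obtain ⟨x, -, hx⟩ := hidx m' hm'
      rw [hm'.and, hx, hx, hx, mem_inter_iff]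
    · have h3 := (hw.imp _ _).1 (hw.provable _ (.C3 (χ A) (χ B) (χ C))) ((hw.and _ _).2 ⟨h1, h2⟩)
      refine (hw.cond_congr_left fun m' hm' => ?_).1 h3
      obtain ⟨x, -, hx⟩ := hidx m' hm'
      rw [hm'.or, hx, hx, hx, mem_union]
    · have h3 := (hw.imp _ _).1 (hw.provable _ (.C4 (χ A) (χ B) (χ C))) ((hw.and _ _).2 ⟨h1, h2⟩)
      refine (hw.cond_congr_left fun m' hm' => ?_).1 h3
      obtain ⟨x, -, hx⟩ := hidx m' hm'
      rw [hm'.and, hx, hx, hx, mem_inter_iff]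
    -- C1 and C2 first give `A → A ∩ B`, since `weaken` assumes only `A ∩ B ⊆ C`.
    · have h3 := (hw.imp _ _).1 (hw.provable _ (.C2 (χ A) (χ A) (χ B)))
        ((hw.and _ _).2 ⟨hw.provable _ (.C1 _), h1⟩)
      refine hw.cond_mono_right (fun m' hm' h => ?_) h3
      obtain ⟨x, -, hx⟩ := hidx m' hm'
      rw [hm'.and, hx, hx] at h
      exact (hx C).2 (h2 h)
  have hrat : axC5 Φ ⊆ Ax → ∀ w, IsRational Set.univ (r w) := by
    intro h5 w A _ B _ C _ h1 h2
    have hw := hm w.down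
    have h3 := (hw.imp _ _).1 (hw.provable _ (.extra (h5 ⟨χ A, χ B, χ C, rfl⟩)))
    rw [hw.and, hw.neg] at h3
    have h4 := h3 ⟨h1, fun hc => h2 ((hw.cond_congr_right fun m' hm' => ?_).1 hc)⟩
    · refine (hw.cond_congr_left fun m' hm' => ?_).1 h4
      obtain ⟨x, -, hx⟩ := hidx m' hm'
      rw [hm'.and, hx, hx, hx, mem_inter_iff]
    · obtain ⟨x, -, hx⟩ := hidx m' hm'
      rw [hm'.neg, hx, hx, mem_compl_iff]
  have hnorm : ∀ w, ¬ r w univ ∅ := by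
    intro w h
    have hw := hm w.down
    refine (hw.neg _).1 (hw.provable _ (.extra (h6 ⟨φ₀, rfl⟩))) ?_
    refine (hw.cond_congr_left fun m' hm' => ?_).1 ((hw.cond_congr_right fun m' hm' => ?_).1 h)
    · obtain ⟨x, -, hx⟩ := hidx m' hm'
      rw [hx, tru, hm'.or, hm'.neg]
      exact iff_of_true trivial (em _)
    · obtain ⟨x, -, hx⟩ := hidx m' hm'
      rw [hx, fls, tru, hm'.neg, hm'.or, hm'.neg]
      exact iff_of_false (fun h => h) fun h => h (em _)
  choose S hS hev hrel using fun w => hQ D (r w) (hpref w) (fun h5 => hrat h5 w) (hnorm w)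
  let M : PlausibilityStructure.{u, v} Φ :=
    { World := W
      dom := fun _ => univ
      space := S
      val := fun w p => m w.down (atom p)
      measurable := fun w φ => by rw [hev w]; trivial }
  have htruth : ∀ φ ∈ subformulas φ₀, ∀ w : W, Sat M.toPreStructure w φ ↔ m w.down φ := by
    intro φ
    induction φ with
    | atom p => exact fun _ _ => Iff.rfl
    | neg φ ih =>
      intro h w
      rw [(hm _).neg, ← ih (subformulas_subset h (mem_insert_of_mem _ (mem_subformulas_self φ))) w]
      rfl
    | and φ ψ ih1 ih2 =>
      intro h w
      rw [(hm _).and,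
        ← ih1 (subformulas_subset h (mem_insert_of_mem _ (Or.inl (mem_subformulas_self φ)))) w,
        ← ih2 (subformulas_subset h (mem_insert_of_mem _ (Or.inr (mem_subformulas_self ψ)))) w]
      rfl
    | cond φ ψ ih1 ih2 =>
      intro h w
      have hφ := subformulas_subset h (mem_insert_of_mem _ (Or.inl (mem_subformulas_self φ)))
      have hψ := subformulas_subset h (mem_insert_of_mem _ (Or.inr (mem_subformulas_self ψ)))
      refine (hrel w _ _).trans ?_
      -- By induction the truth set of a subformula consists of the worlds whose theory contains it,
      -- so its characteristic formula is equivalent to the subformula in every model.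
      refine ((hm w.down).cond_congr_left fun m' hm' => ?_).trans
        ((hm w.down).cond_congr_right fun m' hm' => ?_)
      · obtain ⟨x, hx, hx'⟩ := hidx m' hm'
        exact (hx' _).trans ((ih1 hφ x.1).trans (hx φ hφ).symm)
      · obtain ⟨x, hx, hx'⟩ := hidx m' hm'
        exact (hx' _).trans ((ih2 hψ x.1).trans (hx ψ hψ).symm)
  obtain ⟨i, hi, -⟩ := hex m₀ hm₀
  have h0 := mem_subformulas_self φ₀
  exact (hi φ₀ h0).2 ((htruth φ₀ h0 ⟨i⟩).1 (hvalid M hS ⟨i⟩))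

end Completeness
end CondLogic

/-- Ranking structures are possibility structures, so soundness descends from the larger class and
completeness ascends from the smaller one. -/
theorem mainTheorem9 (Φ : Type u) :
    (CondLogic.Sound (CondLogic.axC6 Φ) (CondLogic.epsilonStructures.{u, v} Φ) ∧
      CondLogic.Complete (CondLogic.axC6 Φ) (CondLogic.epsilonStructures.{u, v} Φ)) ∧
    (CondLogic.Sound (CondLogic.axC5 Φ ∪ CondLogic.axC6 Φ)
        (CondLogic.rankingStructures.{u, v} Φ) ∧
      CondLogic.Complete (CondLogic.axC5 Φ ∪ CondLogic.axC6 Φ)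
        (CondLogic.rankingStructures.{u, v} Φ)) ∧
    (CondLogic.Sound (CondLogic.axC5 Φ ∪ CondLogic.axC6 Φ)
        (CondLogic.possibilityStructures.{u, v} Φ) ∧
      CondLogic.Complete (CondLogic.axC5 Φ ∪ CondLogic.axC6 Φ)
        (CondLogic.possibilityStructures.{u, v} Φ)) := by
  open CondLogic in
  have hsub : rankingStructures.{u, v} Φ ⊆ possibilityStructures.{u, v} Φ :=
    fun M hM w => (hM w).arisesFromPossibility
  have hsound : Sound (axC5 Φ ∪ axC6 Φ) (possibilityStructures.{u, v} Φ) :=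
    sound_of_isPreferential (fun M hM w => (hM w).isPreferential) fun φ hφ => hφ.elim
      (valid_of_mem_axC5 (fun M hM w => (hM w).isRational) φ)
      (valid_of_mem_axC6 (fun M hM w => (hM w).not_rel_univ_empty) φ)
  have hcomplete : Complete (axC5 Φ ∪ axC6 Φ) (rankingStructures.{u, v} Φ) :=
    complete_of_representation subset_union_right ArisesFromRanking fun Ω _ r h hr h0 =>
      h.exists_arisesFromRanking (hr subset_union_left) h0
  exact ⟨⟨sound_of_isPreferential (fun M hM w => (hM w).isPreferential)
      (valid_of_mem_axC6 fun M hM w => (hM w).not_rel_univ_empty),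
    complete_of_representation Subset.rfl ArisesFromPPD fun Ω _ r h _ h0 =>
      h.exists_arisesFromPPD h0⟩,
    ⟨fun φ hφ M hM => hsound φ hφ M (hsub hM), hcomplete⟩,
    hsound, fun φ hφ => hcomplete φ fun M hM => hφ M (hsub hM)⟩
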